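/- Let $g\ge 0$ and let $M=\Sigma_{g,1}$ be a compact connected oriented surface of genus $g$ with one boundary component $\partial M$; let $\mathring M=M\setminus\partial M$, fix $p_0\in\partial M$, and put $\pi=\pi_1(M,p_0)$. Let $\gamma_0\pi=\pi$ and $\gamma_{i+1}\pi=[\pi,\gamma_i\pi]$. Let $\Gamma=\pi_0\,\mathrm{Homeo}(M,\partial M)$ be the mapping class group of $M$ relative to its boundary, and let $J(i)\subset\Gamma$ be the kernel of the action of $\Gamma$ on $\pi/\gamma_i\pi$. For $n\ge0$ let $F_n(\mathring M)$ be the space of $n$ distinct ordered points of $\mathring M$; $\Gamma$ acts on its integral singular homology. Let $T_{\partial M}\in\Gamma$ be the Dehn twist supported in a closed collar of $\partial M$ (a collar exists). 1. $T_{\partial M}$ acts trivially on $H_i(F_n(\mathring M))$ for all $n,i\ge 0$. 2. Suppose $g\ge 1$. Then $\langle T_{\partial M}\rangle$ is infinite cyclic, it is contained in $J(2)$, and $\langle T_{\partial M}\rangle\cap J(3)=\{1\}$. 3. More precisely, suppose $g\ge1$ and orient $\partial M$, the direction of the twist $T_{\partial M}$ being the one for which $T_{\partial M}$ acts on $\pi$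 as conjugation $x\mapsto cxc^{-1}$ by the class $c\in\pi$ of the boundary loop. There are elements $a_1,b_1,\dots,a_g,b_g$ which freely generate $\pi$ and satisfy $c=[a_1,b_1]\cdots[a_g,b_g]$. For all such elements and every $k\in\mathbb Z$, the element $T_{\partial M}^k(a_1)a_1^{-1}$ lies in $\gamma_2\pi$, and its class in $\gamma_2\pi/\gamma_3\pi$, written additively, is $$k\sum_{j=1}^g\big[[A_j,B_j],A_1\big],$$ which is nonzero if $k\ne0$. Here $A_j,B_j\in\gamma_0\pi/\gamma_1\pi$ are the classes of $a_j,b_j$, and the bracket is that of the associated graded Lie ring $\bigoplus_\ell\gamma_\ell\pi/\gamma_{\ell+1}\pi$, induced by the group commutator $[x,y]=xyx^{-1}y^{-1}$. 4. If $g\ge1$, then for all $n\ge0$ and $i\ge3$ the kernel of the action of $\Gamma$ on $H_i(F_n(\mathring M))$ is not contained in $J(i)$; in particular $J(i)$ is not the full kernel of this action. -/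

import Mathlib

open scoped unitInterval commutatorElement

noncomputable section

namespace BoundaryTwist

/-! ### Lower central series and its associated graded Lie ring -/

section LowerCentral

variable {G : Type*} [Group G]

/-- `γ i` is the `i`-th term of the lower central series: `γ 0 = G`, `γ (i + 1) = [γ i, G]`. -/
abbrev lcs (G : Type*) [Group G] (i : ℕ) : Subgroup G :=
  (⊤ : Subgroup G).lowerCentralSeries i

theorem lcs_anti {i j : ℕ} (h : i ≤ j) : lcs G j ≤ lcs G i :=
  (⊤ : Subgroup G).lowerCentralSeries_antitone h

theorem lcs_commutator_le (j : ℕ) : ∀ i : ℕ, ⁅lcs G i, lcs G j⁆ ≤ lcs G (i + j + 1) := by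
  induction j with
  | zero => intro i; exact le_rfl
  | succ j ih =>
    intro i
    set N : Subgroup G := lcs G (i + (j + 1) + 1) with hN
    have key : ∀ K : Subgroup G, K.map (QuotientGroup.mk' N) = ⊥ ↔ K ≤ N := by
      intro K
      rw [Subgroup.map_eq_bot_iff, QuotientGroup.ker_mk']
    have h1 : ⁅⁅(⊤ : Subgroup G), lcs G i⁆, lcs G j⁆ ≤ N := by
      rw [Subgroup.commutator_comm ⊤ (lcs G i)]
      refine (ih (i + 1)).trans ?_
      exact lcs_anti (by omega)
    have h2 : ⁅⁅lcs G i, lcs G j⁆, (⊤ : Subgroup G)⁆ ≤ N := by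
      refine (Subgroup.commutator_mono (ih i) le_rfl).trans ?_
      exact lcs_anti (i := i + (j + 1) + 1) (j := i + j + 1 + 1) (by omega)
    have h3 : ⁅⁅lcs G j, (⊤ : Subgroup G)⁆, lcs G i⁆ ≤ N := by
      rw [← key, Subgroup.map_commutator, Subgroup.map_commutator]
      apply Subgroup.commutator_commutator_eq_bot_of_rotate
      · rw [← Subgroup.map_commutator, ← Subgroup.map_commutator, key]; exact h1
      · rw [← Subgroup.map_commutator, ← Subgroup.map_commutator, key]; exact h2
    rw [Subgroup.commutator_comm]
    exact h3

theorem commutator_mem_lcs {i j : ℕ} {x y : G} (hx : x ∈ lcs G i) (hy : y ∈ lcs G j) :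
    ⁅x, y⁆ ∈ lcs G (i + j + 1) :=
  lcs_commutator_le j i (Subgroup.commutator_mem_commutator hx hy)

/-- The quotient group `γ i / γ (i + 1)`, in multiplicative notation. -/
abbrev GrMul (G : Type*) [Group G] (i : ℕ) : Type _ :=
  lcs G i ⧸ (lcs G (i + 1)).subgroupOf (lcs G i)

instance grMulCommGroup (i : ℕ) : CommGroup (GrMul G i) :=
  { (inferInstance : Group (GrMul G i)) with
    mul_comm := by
      intro a b
      induction a using QuotientGroup.induction_on with | _ x
      induction b using QuotientGroup.induction_on with | _ y
      rw [← QuotientGroup.mk_mul, ← QuotientGroup.mk_mul, QuotientGroup.eq,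
        Subgroup.mem_subgroupOf]
      have h : ⁅(y : G)⁻¹, (x : G)⁻¹⁆ ∈ lcs G (i + 1) :=
        lcs_anti (by omega) (commutator_mem_lcs (inv_mem y.2) (inv_mem x.2))
      have e : (((x * y)⁻¹ * (y * x) : lcs G i) : G) = ⁅(y : G)⁻¹, (x : G)⁻¹⁆ := by
        simp [commutatorElement_def, mul_assoc]
      rw [e]; exact h }

/-- The degree `i` part `γ i / γ (i + 1)` of the associated graded Lie ring of the lower
central series, written additively. -/
abbrev Gr (G : Type*) [Group G] (i : ℕ) : Type _ := Additive (GrMul G i)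

/-- The class in `γ i / γ (i + 1)` of an element of `γ i`. -/
def grMk {i : ℕ} (x : G) (hx : x ∈ lcs G i) : Gr G i :=
  Additive.ofMul (QuotientGroup.mk (⟨x, hx⟩ : lcs G i))

theorem commutator_congr {i j : ℕ} {x x' y y' : G} (hx : x ∈ lcs G i) (hy' : y' ∈ lcs G j)
    (hu : x⁻¹ * x' ∈ lcs G (i + 1)) (hv : y⁻¹ * y' ∈ lcs G (j + 1)) :
    ⁅x, y⁆⁻¹ * ⁅x', y'⁆ ∈ lcs G (i + j + 1 + 1) := by
  set N := lcs G (i + j + 1 + 1) with hN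
  obtain ⟨u, rfl⟩ : ∃ u, x' = x * u := ⟨x⁻¹ * x', by group⟩
  obtain ⟨v, rfl⟩ : ∃ v, y' = y * v := ⟨y⁻¹ * y', by group⟩
  rw [inv_mul_cancel_left] at hu hv
  have c1 : ⁅u, y * v⁆ ∈ N := lcs_anti (by omega) (commutator_mem_lcs hu hy')
  have c2 : ⁅x, v⁆ ∈ N := lcs_anti (by omega) (commutator_mem_lcs hx hv)
  have e : ⁅x, y⁆⁻¹ * ⁅x * u, y * v⁆ =
      (⁅x, y⁆⁻¹ * (x * ⁅u, y * v⁆ * x⁻¹) * ⁅x, y⁆) * (y * ⁅x, v⁆ * y⁻¹) := by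
    simp only [commutatorElement_def]; group
  rw [e]
  have hNn : N.Normal := inferInstance
  refine mul_mem ?_ (hNn.conj_mem _ c2 y)
  have := hNn.conj_mem _ (hNn.conj_mem _ c1 x) ⁅x, y⁆⁻¹
  rwa [inv_inv] at this

/-- The Lie bracket `γ i / γ (i + 1) × γ j / γ (j + 1) → γ (i + j + 1) / γ (i + j + 2)` induced by
the group commutator `⁅x, y⁆ = x * y * x⁻¹ * y⁻¹`. -/
def grBracket {i j : ℕ} (a : Gr G i) (b : Gr G j) : Gr G (i + j + 1) :=
  Additive.ofMul <| Quotient.map₂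
    (fun (x : lcs G i) (y : lcs G j) =>
      (⟨⁅(x : G), (y : G)⁆, commutator_mem_lcs x.2 y.2⟩ : lcs G (i + j + 1)))
    (by
      intro x x' hx y y' hy
      replace hx := QuotientGroup.leftRel_apply.1 hx
      replace hy := QuotientGroup.leftRel_apply.1 hy
      refine QuotientGroup.leftRel_apply.2 ?_
      rw [Subgroup.mem_subgroupOf] at hx hy ⊢
      exact commutator_congr x.2 y'.2 hx hy)
    a.toMul b.toMul

theorem grBracket_mk {i j : ℕ} {x y : G} (hx : x ∈ lcs G i) (hy : y ∈ lcs G j) :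
    grBracket (grMk x hx) (grMk y hy) = grMk ⁅x, y⁆ (commutator_mem_lcs hx hy) := rfl

theorem lcs_map_le (f : G →* G) (i : ℕ) : lcs G i ≤ (lcs G i).comap f := by
  rw [← Subgroup.map_le_iff_le_comap, Subgroup.map_lowerCentralSeries]
  induction i with
  | zero => exact le_top
  | succ n ih => exact Subgroup.commutator_mono ih le_top

end LowerCentral

/-! ### The surface of genus `g` with one boundary component -/

/-- Identifications on the annulus `S¹ × [0, 1]`. The circle `S¹ × {1}` is divided into `4g` arcs,
read as the word `∏ᵢ aᵢ bᵢ aᵢ⁻¹ bᵢ⁻¹`: for `i < g` the arcs number `4i` and `4i + 2` are identified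
with opposite directions, and so are the arcs number `4i + 1` and `4i + 3`. If `g = 0`, the whole
circle `S¹ × {1}` is collapsed to a point. -/
inductive SurfaceRel (g : ℕ) : Circle × I → Circle × I → Prop
  | a (i : ℕ) (hi : i < g) (u : I) :
      SurfaceRel g (Circle.exp (2 * Real.pi * ((4 * i + u) / (4 * g))), 1)
        (Circle.exp (2 * Real.pi * ((4 * i + 3 - u) / (4 * g))), 1)
  | b (i : ℕ) (hi : i < g) (u : I) :
      SurfaceRel g (Circle.exp (2 * Real.pi * ((4 * i + 1 + u) / (4 * g))), 1)
        (Circle.exp (2 * Real.pi * ((4 * i + 4 - u) / (4 * g))), 1)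
  | disc (hg : g = 0) (z w : Circle) : SurfaceRel g (z, 1) (w, 1)

/-- The standard compact oriented surface `Σ_{g,1}`: a `4g`-gon from which an open disc has been
removed, with its sides identified in pairs according to `∏ᵢ aᵢ bᵢ aᵢ⁻¹ bᵢ⁻¹` (a closed disc if
`g = 0`). -/
def Model (g : ℕ) : Type := Quot (SurfaceRel g)

instance (g : ℕ) : TopologicalSpace (Model g) :=
  inferInstanceAs (TopologicalSpace (Quot (SurfaceRel g)))

/-- The boundary circle of `Σ_{g,1}`, the image of `S¹ × {0}`. -/
def modelBoundary (g : ℕ) : Set (Model g) :=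
  {x | ∃ z : Circle, x = Quot.mk (SurfaceRel g) (z, 0)}

/-- `(M, B)` is a compact connected orientable surface of genus `g` with one boundary component
`B = ∂M`, that is, `(M, B)` is homeomorphic to `(Σ_{g,1}, ∂Σ_{g,1})`. -/
def IsSurface (g : ℕ) (M : Type) [TopologicalSpace M] (B : Set M) : Prop :=
  ∃ e : Model g ≃ₜ M, e '' modelBoundary g = B

/-! ### The mapping class group -/

section MappingClass

variable {M : Type} [TopologicalSpace M]

/-- The group of homeomorphisms of `M` that fix `B` pointwise. -/
def HomeoFix (B : Set M) : Subgroup (M ≃ₜ M) where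
  carrier := {f | ∀ x ∈ B, f x = x}
  one_mem' := fun _ _ => rfl
  mul_mem' := by
    intro f h hf hh x hx
    rw [Homeomorph.mul_apply, hh x hx, hf x hx]
  inv_mem' := by
    intro f hf x hx
    rw [Homeomorph.inv_apply, Homeomorph.symm_apply_eq, hf x hx]

variable (B : Set M)

/-- The homeomorphisms isotopic to the identity through homeomorphisms fixing `B` pointwise.
For compact `M` this is the path component of the identity for the compact-open topology. -/
def isotopicToId : Subgroup (HomeoFix B) where
  carrier := {f | ∃ H : I → HomeoFix B,
    Continuous (fun p : I × M => (H p.1 : M ≃ₜ M) p.2) ∧ H 0 = 1 ∧ H 1 = f}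
  one_mem' := ⟨fun _ => 1, continuous_snd, rfl, rfl⟩
  mul_mem' := by
    rintro f h ⟨F, hF, F0, F1⟩ ⟨K, hK, K0, K1⟩
    refine ⟨fun t => F t * K t, ?_, by simp [F0, K0], by simp [F1, K1]⟩
    exact hF.comp (continuous_fst.prodMk hK)
  inv_mem' := by
    rintro f ⟨F, hF, F0, F1⟩
    refine ⟨fun t => f⁻¹ * F (σ t), ?_, by simp [F1], by simp [F0]⟩
    exact ((f⁻¹ : HomeoFix B) : M ≃ₜ M).continuous.comp
      (hF.comp ((unitInterval.continuous_symm.comp continuous_fst).prodMk continuous_snd))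

instance isotopicToId_normal : (isotopicToId B).Normal where
  conj_mem := by
    rintro f ⟨F, hF, F0, F1⟩ h
    refine ⟨fun t => h * F t * h⁻¹, ?_, by simp [F0], by simp [F1]⟩
    exact (h : M ≃ₜ M).continuous.comp (hF.comp (continuous_fst.prodMk
      (((h⁻¹ : HomeoFix B) : M ≃ₜ M).continuous.comp continuous_snd)))

/-- The mapping class group `Γ(M, B) = π₀ Homeo(M, B)`. -/
abbrev MCG : Type := HomeoFix B ⧸ isotopicToId B

variable {B}

/-! ### The action on the fundamental group and the Johnson filtration -/

/-- A homeomorphism fixing `B` pointwise, as a continuous map. -/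
def toMap (f : HomeoFix B) : C(M, M) := ⟨(f : M ≃ₜ M), (f : M ≃ₜ M).continuous⟩

theorem mapOfEq_mk (f : C(M, M)) {p : M} (h : f p = p) (γ : Path p p) :
    FundamentalGroup.mapOfEq f h (Path.Homotopic.Quotient.mk γ) =
      Path.Homotopic.Quotient.mk ((γ.map f.continuous).cast h.symm h.symm) :=
  FundamentalGroup.mapOfEq_apply _ _ _

theorem pi_hom_ext {p : M} {φ ψ : Monoid.End (FundamentalGroup M p)}
    (h : ∀ γ : Path p p, φ (Path.Homotopic.Quotient.mk γ) = ψ (Path.Homotopic.Quotient.mk γ)) :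
    φ = ψ := by
  refine MonoidHom.ext fun x => ?_
  obtain ⟨γ, rfl⟩ := Path.Homotopic.Quotient.mk_surjective x
  exact h γ

/-- The action of `Homeo(M, B)` on `π₁(M, p)`, where `p ∈ B`. -/
def homeoPi (p : B) : HomeoFix B →* Monoid.End (FundamentalGroup M (p : M)) where
  toFun f := FundamentalGroup.mapOfEq (toMap f) (f.2 p p.2)
  map_one' := by
    refine pi_hom_ext fun γ => ?_
    exact mapOfEq_mk _ _ _
  map_mul' := by
    intro f h
    refine pi_hom_ext fun γ => ?_
    refine (mapOfEq_mk _ _ _).trans ?_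
    refine Eq.trans ?_ (congrArg (FundamentalGroup.mapOfEq (toMap f) (f.2 p p.2))
      (mapOfEq_mk (toMap h) (h.2 p p.2) γ)).symm
    exact (mapOfEq_mk (toMap f) (f.2 p p.2)
      ((γ.map (toMap h).continuous).cast (h.2 p p.2).symm (h.2 p p.2).symm)).symm

theorem homeoPi_mk (p : B) (f : HomeoFix B) (γ : Path (p : M) p) :
    homeoPi p f (Path.Homotopic.Quotient.mk γ) = Path.Homotopic.Quotient.mk
      ((γ.map (toMap f).continuous).cast (f.2 p p.2).symm (f.2 p p.2).symm) :=
  mapOfEq_mk (toMap f) (f.2 p p.2) γ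

theorem homeoPi_isotopy (p : B) : isotopicToId B ≤ (homeoPi p).ker := by
  rintro f ⟨F, hF, F0, F1⟩
  rw [MonoidHom.mem_ker, ← map_one (homeoPi p)]
  refine pi_hom_ext fun γ => ?_
  rw [homeoPi_mk, homeoPi_mk]
  refine (Path.Homotopic.Quotient.eq.2 (Path.Homotopic.symm ⟨?_⟩))
  exact
    { toFun := fun q => (F q.1 : M ≃ₜ M) (γ q.2)
      continuous_toFun := hF.comp (continuous_fst.prodMk (γ.continuous.comp continuous_snd))
      map_zero_left := by intro s; rw [F0]; rfl
      map_one_left := by intro s; rw [F1]; rfl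
      prop' := by
        intro t s hs
        rcases hs with rfl | rfl
        · simpa using (F t).2 p p.2
        · simpa using (F t).2 p p.2 }

/-- The action of the mapping class group on `π = π₁(M, p)`, where `p ∈ B`. -/
def piAction (p : B) : MCG B →* Monoid.End (FundamentalGroup M (p : M)) :=
  QuotientGroup.lift _ (homeoPi p) (homeoPi_isotopy p)

/-- The action of the mapping class group on the quotient `π / γ i` of `π = π₁(M, p)`. -/
def lcsQuotientAction (p : B) (i : ℕ) :
    MCG B →* Monoid.End (FundamentalGroup M (p : M) ⧸ lcs (FundamentalGroup M (p : M)) i) where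
  toFun f := QuotientGroup.map _ _ (piAction p f) (lcs_map_le _ i)
  map_one' := by
    refine MonoidHom.ext fun x => ?_
    induction x using QuotientGroup.induction_on with | _ x
    exact congrArg QuotientGroup.mk (DFunLike.congr_fun (map_one (piAction p)) x)
  map_mul' := by
    intro f h
    refine MonoidHom.ext fun x => ?_
    induction x using QuotientGroup.induction_on with | _ x
    exact congrArg QuotientGroup.mk (DFunLike.congr_fun (map_mul (piAction p) f h) x)

/-- The `i`-th stage `J(i)` of the Johnson filtration: the kernel of the action on `π / γ i`. -/
def johnson (p : B) (i : ℕ) : Subgroup (MCG B) := (lcsQuotientAction p i).ker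

/-! ### The action on the homology of configuration spaces -/

/-- The space `F_n(M \ B)` of `n` distinct ordered points of `M \ B`. -/
abbrev Conf (n : ℕ) (B : Set M) : Type :=
  {z : Fin n → M // Function.Injective z ∧ ∀ j, z j ∉ B}

theorem homeo_notMem (f : HomeoFix B) {x : M} (hx : x ∉ B) : (f : M ≃ₜ M) x ∉ B := by
  intro h
  have h1 : (f : M ≃ₜ M) x = x := (f : M ≃ₜ M).injective (f.2 _ h)
  exact hx (h1 ▸ h)

/-- The action of a homeomorphism on `F_n(M \ B)`. -/
def confMap (n : ℕ) (f : HomeoFix B) : C(Conf n B, Conf n B) where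
  toFun z := ⟨fun j => (f : M ≃ₜ M) (z.1 j),
    (f : M ≃ₜ M).injective.comp z.2.1, fun j => homeo_notMem f (z.2.2 j)⟩
  continuous_toFun := by
    refine Continuous.subtype_mk (continuous_pi fun j => ?_) _
    exact (f : M ≃ₜ M).continuous.comp ((continuous_apply j).comp continuous_subtype_val)

/-- Singular homology `H_i(-; ℤ)`. -/
abbrev integralHomology (i : ℕ) : CategoryTheory.Functor TopCat.{0} (ModuleCat.{0} ℤ) :=
  (AlgebraicTopology.singularHomologyFunctor (ModuleCat.{0} ℤ) i).obj (ModuleCat.of ℤ ℤ)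

/-- The homology group `H_i(F_n(M \ B); ℤ)`. -/
abbrev confHomology (n i : ℕ) (B : Set M) : ModuleCat.{0} ℤ :=
  (integralHomology i).obj (TopCat.of (Conf n B))

/-- The action of `Homeo(M, B)` on `H_i(F_n(M \ B); ℤ)`. -/
def homeoHomology (n i : ℕ) : HomeoFix B →* Module.End ℤ (confHomology n i B) where
  toFun f := ((integralHomology i).map (TopCat.ofHom (confMap n f))).hom
  map_one' := by
    have h : TopCat.ofHom (confMap n (1 : HomeoFix B)) =
        CategoryTheory.CategoryStruct.id (TopCat.of (Conf n B)) := rfl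
    rw [h, CategoryTheory.Functor.map_id]
    rfl
  map_mul' := by
    intro f h
    have e : TopCat.ofHom (confMap n (f * h)) = CategoryTheory.CategoryStruct.comp
        (TopCat.ofHom (confMap n h)) (TopCat.ofHom (confMap n f)) := rfl
    rw [e, CategoryTheory.Functor.map_comp]
    rfl

theorem homeoHomology_isotopy (n i : ℕ) : isotopicToId B ≤ (homeoHomology (B := B) n i).ker := by
  rintro f ⟨F, hF, F0, F1⟩
  rw [MonoidHom.mem_ker, ← map_one (homeoHomology (B := B) n i)]
  have H : TopCat.Homotopy (TopCat.ofHom (confMap n (1 : HomeoFix B)))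
      (TopCat.ofHom (confMap n f)) :=
    { toFun := fun q => confMap n (F q.1) q.2
      continuous_toFun := by
        refine Continuous.subtype_mk (continuous_pi fun j => ?_) _
        exact hF.comp (continuous_fst.prodMk
          ((continuous_apply j).comp (continuous_subtype_val.comp continuous_snd)))
      map_zero_left := by intro z; rw [F0]; rfl
      map_one_left := by intro z; rw [F1]; rfl }
  exact congrArg ModuleCat.Hom.hom
    (H.congr_homologyMap_singularChainComplexFunctor (ModuleCat.of ℤ ℤ) i).symm

/-- The action of the mapping class group on `H_i(F_n(M \ B); ℤ)`. -/
def homologyAction (n i : ℕ) : MCG B →* Module.End ℤ (confHomology n i B) :=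
  QuotientGroup.lift _ (homeoHomology n i) (homeoHomology_isotopy n i)

end MappingClass

/-! ### The boundary Dehn twist -/

section Twist

variable {M : Type} [TopologicalSpace M]

/-- A parametrised closed collar `S¹ × [0, 1] → M` of `B`, with `B` corresponding to
`S¹ × {0}`. -/
structure Collar (B : Set M) where
  toFun : Circle × I → M
  isClosedEmbedding : Topology.IsClosedEmbedding toFun
  image_zero : toFun '' {q | q.2 = 0} = B
  isOpen_image : IsOpen (toFun '' {q | q.2 < 1})

namespace Collar

/-- `(z, t) ↦ (z * exp (2 π i k t), t)`. -/
def rot (k : ℤ) (q : Circle × I) : Circle × I :=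
  (q.1 * Circle.exp (2 * Real.pi * (k * q.2)), q.2)

theorem continuous_rot (k : ℤ) : Continuous (rot k) := by
  unfold rot
  refine Continuous.prodMk (continuous_fst.mul (Circle.exp.continuous.comp ?_)) continuous_snd
  exact continuous_const.mul (continuous_const.mul (continuous_subtype_val.comp continuous_snd))

theorem rot_neg (k : ℤ) (q : Circle × I) : rot (-k) (rot k q) = q := by
  refine Prod.ext ?_ rfl
  simp only [rot]
  rw [mul_assoc, ← Circle.exp_add]
  have : 2 * Real.pi * (k * (q.2 : ℝ)) + 2 * Real.pi * (((-k : ℤ) : ℝ) * q.2) = 0 := by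
    push_cast; ring
  rw [this, Circle.exp_zero, mul_one]

theorem rot_zero (k : ℤ) (z : Circle) : rot k (z, 0) = (z, 0) := by
  simp [rot]

theorem rot_one (k : ℤ) (z : Circle) : rot k (z, 1) = (z, 1) := by
  refine Prod.ext ?_ rfl
  have : Circle.exp (2 * Real.pi * k) = 1 := by
    rw [Circle.exp_eq_one]; exact ⟨k, by ring⟩
  simp [rot, this]

variable {B : Set M} (φ : Collar B)

open Classical in
/-- The map which is `φ(z, t) ↦ φ(z * exp (2 π i k t), t)` on the collar, the identity elsewhere. -/
def twistMap (k : ℤ) (x : M) : M :=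
  if h : ∃ q, φ.toFun q = x then φ.toFun (rot k h.choose) else x

theorem twistMap_apply (k : ℤ) (q : Circle × I) :
    φ.twistMap k (φ.toFun q) = φ.toFun (rot k q) := by
  have h : ∃ q', φ.toFun q' = φ.toFun q := ⟨q, rfl⟩
  rw [twistMap, dif_pos h, φ.isClosedEmbedding.injective h.choose_spec]

theorem twistMap_of_notMem (k : ℤ) {x : M} (hx : x ∉ Set.range φ.toFun) :
    φ.twistMap k x = x := dif_neg hx

theorem continuous_twistMap (k : ℤ) : Continuous (φ.twistMap k) := by
  have h1 : ContinuousOn (φ.twistMap k) (Set.range φ.toFun) := by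
    rw [continuousOn_iff_continuous_domRestrict]
    have e : Continuous fun q => φ.twistMap k (φ.toFun q) := by
      simp only [twistMap_apply]
      exact φ.isClosedEmbedding.continuous.comp (continuous_rot k)
    have q := φ.isClosedEmbedding.isEmbedding.toHomeomorph.isQuotientMap
    rw [q.continuous_iff]
    exact e
  have h2 : ContinuousOn (φ.twistMap k) (φ.toFun '' {q | q.2 < 1})ᶜ := by
    refine continuousOn_id.congr fun x hx => ?_
    by_cases hr : x ∈ Set.range φ.toFun
    · obtain ⟨⟨z, t⟩, rfl⟩ := hr
      have ht : t = 1 := by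
        by_contra hne
        exact hx ⟨(z, t), lt_of_le_of_ne unitInterval.le_one' hne, rfl⟩
      subst ht
      rw [twistMap_apply, rot_one]; rfl
    · exact φ.twistMap_of_notMem k hr
  have h3 := h1.union_of_isClosed h2 φ.isClosedEmbedding.isClosed_range
    φ.isOpen_image.isClosed_compl
  have h4 : Set.range φ.toFun ∪ (φ.toFun '' {q | q.2 < 1})ᶜ = Set.univ := by
    refine Set.eq_univ_of_forall fun x => ?_
    by_cases hr : x ∈ Set.range φ.toFun
    · exact Or.inl hr
    · exact Or.inr fun h => hr (Set.image_subset_range _ _ h)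
  rw [h4] at h3
  exact continuousOn_univ.1 h3

theorem twistMap_neg (k : ℤ) (x : M) : φ.twistMap (-k) (φ.twistMap k x) = x := by
  by_cases hr : x ∈ Set.range φ.toFun
  · obtain ⟨q, rfl⟩ := hr
    rw [twistMap_apply, twistMap_apply, rot_neg]
  · rw [φ.twistMap_of_notMem k hr, φ.twistMap_of_notMem (-k) hr]

/-- The homeomorphism `φ(z, t) ↦ φ(z * exp (- 2 π i t), t)`, extended by the identity outside of
the collar. -/
def twistHomeo : HomeoFix B :=
  ⟨{ toFun := φ.twistMap (-1)
     invFun := φ.twistMap 1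
     left_inv := φ.twistMap_neg (-1)
     right_inv := φ.twistMap_neg 1
     continuous_toFun := φ.continuous_twistMap (-1)
     continuous_invFun := φ.continuous_twistMap 1 }, by
    intro x hx
    rw [← φ.image_zero] at hx
    obtain ⟨⟨z, t⟩, ht, rfl⟩ := hx
    obtain rfl : t = 0 := ht
    exact (φ.twistMap_apply (-1) (z, 0)).trans (by rw [rot_zero])⟩

/-- The boundary Dehn twist `T_∂M`, as a mapping class. -/
def dehnTwist : MCG B := QuotientGroup.mk φ.twistHomeo

theorem exists_angle (p : B) : ∃ z : Circle, φ.toFun (z, 0) = p := by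
  have h : (p : M) ∈ φ.toFun '' {q | q.2 = 0} := φ.image_zero.symm ▸ p.2
  obtain ⟨⟨z, t⟩, ht, hz⟩ := h
  obtain rfl : t = 0 := ht
  exact ⟨z, hz⟩

/-- The boundary loop `s ↦ φ(z * exp (2 π i s), 0)` based at `p = φ(z, 0)`. -/
def boundaryLoop (p : B) : Path (p : M) p where
  toFun s := φ.toFun ((φ.exists_angle p).choose * Circle.exp (2 * Real.pi * s), 0)
  continuous_toFun := by
    refine φ.isClosedEmbedding.continuous.comp (Continuous.prodMk
      (continuous_const.mul (Circle.exp.continuous.comp ?_)) continuous_const)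
    exact continuous_const.mul continuous_subtype_val
  source' := by
    simpa using (φ.exists_angle p).choose_spec
  target' := by
    simpa using (φ.exists_angle p).choose_spec

/-- The class of the boundary loop in `π₁(M, p)`. -/
def boundaryClass (p : B) : FundamentalGroup M (p : M) :=
  Path.Homotopic.Quotient.mk (φ.boundaryLoop p)

/-- The elements `a₁, b₁, …, a_g, b_g` freely generate `π = π₁(M, p)`, and the boundary loop
represents `⁅a₁, b₁⁆ ⋯ ⁅a_g, b_g⁆`. -/
def IsAdaptedBasis (p : B) {g : ℕ} (a b : Fin g → FundamentalGroup M (p : M)) : Prop :=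
  Function.Bijective (FreeGroup.lift (Sum.elim a b)) ∧
    φ.boundaryClass p = (List.ofFn fun j => ⁅a j, b j⁆).prod

end Collar

end Twist

end BoundaryTwist

end

open scoped unitInterval commutatorElement

noncomputable section

namespace BoundaryTwist

/-! ### Arithmetic in the associated graded Lie ring -/

section GradedArithmetic

variable {G : Type*} [Group G]

/-! The twist becomes trivial once the boundary may turn: in the collar, rotation by the angle
`-2π(1 - s(1 - t))` is a full turn at `s = 0`, the twist at `s = 1`, and always a full turn at the
inner end `t = 1`. This isotopy preserves `M \ B`, so it induces a homotopy on every configuration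
space, and the twist acts trivially on homology. It moves the base point once around the boundary,
so the twist acts on `π` as conjugation by the boundary class `c` (`homologyAction_dehnTwist`,
`piAction_dehnTwist`).

The rest is algebra, given a free basis with `c = ∏ ⁅aⱼ, bⱼ⁆`. Then `c` lies in `γ 1`, and `T ^ k
(x) * x⁻¹ = ⁅c ^ k, x⁆` lies in `γ 2`, with class given by linearity of the bracket. To see that it
is outside of `γ 3` for `x = a₁` and `k ≠ 0`, map `a₁, b₁` to two unitriangular `4 × 4` matrices and
the other generators to `1`: `γ 3` dies, whereas the corner entry of the image is a nonzero multiple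
of `k` (`commutator_zpow_notMem`). Hence `T` has infinite order, its powers meet `J(3)` trivially,
and `T` itself shows that the kernel on homology is not inside `J(i)` for `i ≥ 3`.

The existence of the basis is the long part. The surface is a quotient of the strip `ℝ × [0, 1]`,
which is simply connected, so a path class that lifts to the strip depends only on the ends of the
lift. The arcs on the line `t = 1` generate `π`: the surface deforms onto them, and a path cut
finely enough has pieces whose deformed images lift to the strip (`good_mk`). The basic arcs are
free because a covering with fibre the free group has the left regular representation as its
monodromy (`lift_basicArc_injective`). Reading once along the polygon gives the product of
commutators. A collar may run along the boundary in either direction, so both signs are treated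
(`exists_basis`). -/

theorem grMk_congr {i : ℕ} {x y : G} (hx : x ∈ lcs G i) (h : x = y) :
    grMk x hx = grMk y (h ▸ hx) := by subst h; rfl

theorem grMk_mul {i : ℕ} {x y : G} (hx : x ∈ lcs G i) (hy : y ∈ lcs G i) :
    grMk (x * y) (mul_mem hx hy) = grMk x hx + grMk y hy := rfl

theorem grMk_zpow {i : ℕ} {x : G} (hx : x ∈ lcs G i) (k : ℤ) :
    grMk (x ^ k) (zpow_mem hx k) = k • grMk x hx := rfl

theorem grMk_eq_zero_iff {i : ℕ} {x : G} (hx : x ∈ lcs G i) :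
    grMk x hx = 0 ↔ x ∈ lcs G (i + 1) := by
  refine Iff.trans ?_ (Subgroup.mem_subgroupOf (h := ⟨x, hx⟩))
  exact QuotientGroup.eq_one_iff _

/-- Conjugation changes an element of `γ i` by the factor `⁅y, x⁆`, which lies one step deeper. -/
theorem grMk_conj {i : ℕ} {x : G} (hx : x ∈ lcs G i) (y : G) (h : y * x * y⁻¹ ∈ lcs G i) :
    grMk (y * x * y⁻¹) h = grMk x hx := by
  have hc : ⁅y, x⁆ ∈ lcs G (i + 1) :=
    lcs_anti (by omega) (commutator_mem_lcs (i := 0) (Subgroup.mem_top y) hx)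
  have e : y * x * y⁻¹ = ⁅y, x⁆ * x := by rw [commutatorElement_def]; group
  have hc' : ⁅y, x⁆ ∈ lcs G i := lcs_anti (by omega) hc
  rw [grMk_congr h e, grMk_mul hc' hx, (grMk_eq_zero_iff hc').2 hc, zero_add]

theorem grMk_surjective {i : ℕ} (a : Gr G i) : ∃ x, ∃ hx : x ∈ lcs G i, a = grMk x hx := by
  obtain ⟨⟨x, hx⟩, h⟩ := QuotientGroup.mk_surjective a.toMul
  exact ⟨x, hx, congrArg Additive.ofMul h.symm⟩

/-- This is the identity `⁅x * y, z⁆ = x * ⁅y, z⁆ * x⁻¹ * ⁅x, z⁆`, in which the conjugation is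
invisible in the graded ring. Linearity in the left argument suffices, because powers and products
of commutators only occur there. -/
theorem grBracket_add_left {i j : ℕ} (a b : Gr G i) (d : Gr G j) :
    grBracket (a + b) d = grBracket a d + grBracket b d := by
  obtain ⟨x, hx, rfl⟩ := grMk_surjective a
  obtain ⟨y, hy, rfl⟩ := grMk_surjective b
  obtain ⟨z, hz, rfl⟩ := grMk_surjective d
  have h1 := commutator_mem_lcs hy hz
  have h2 : x * ⁅y, z⁆ * x⁻¹ ∈ lcs G (i + j + 1) :=
    (inferInstance : (lcs G (i + j + 1)).Normal).conj_mem _ h1 x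
  have e : ⁅x * y, z⁆ = (x * ⁅y, z⁆ * x⁻¹) * ⁅x, z⁆ := by
    simp only [commutatorElement_def]; group
  rw [← grMk_mul, grBracket_mk, grBracket_mk, grBracket_mk, grMk_congr _ e,
    grMk_mul h2 (commutator_mem_lcs hx hz), grMk_conj h1 x h2]
  exact add_comm _ _

/-- Bracketing on the right with a fixed element, as a homomorphism. -/
def grBracketHom {i j : ℕ} (d : Gr G j) : Gr G i →+ Gr G (i + j + 1) :=
  AddMonoidHom.mk' (fun a => grBracket a d) fun a b => grBracket_add_left a b d

theorem list_prod_commutator_mem {n : ℕ} (a b : Fin n → G) :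
    (List.ofFn fun j => ⁅a j, b j⁆).prod ∈ lcs G 1 := by
  refine list_prod_mem fun x hx => ?_
  obtain ⟨j, rfl⟩ := List.mem_ofFn.1 hx
  exact commutator_mem_lcs (i := 0) (j := 0) (Subgroup.mem_top _) (Subgroup.mem_top _)

theorem grMk_list_prod_commutator {n : ℕ} (a b : Fin n → G) :
    grMk _ (list_prod_commutator_mem a b) =
      ∑ j, grBracket (i := 0) (j := 0) (grMk (a j) (Subgroup.mem_top _))
        (grMk (b j) (Subgroup.mem_top _)) := by
  induction n with
  | zero => rfl
  | succ n ih =>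
    have e : (List.ofFn fun j => ⁅a j, b j⁆).prod =
        ⁅a 0, b 0⁆ * (List.ofFn fun j : Fin n => ⁅a j.succ, b j.succ⁆).prod := by
      rw [List.ofFn_succ, List.prod_cons]
    rw [Fin.sum_univ_succ, ← ih (fun j => a j.succ) (fun j => b j.succ), grMk_congr _ e,
      grMk_mul (commutator_mem_lcs (i := 0) (j := 0) (Subgroup.mem_top _) (Subgroup.mem_top _))
        (list_prod_commutator_mem _ _)]
    rfl

theorem grMk_commutator_zpow {n : ℕ} (a b : Fin n → G) (x : G) (k : ℤ)
    (h : ⁅(List.ofFn fun j => ⁅a j, b j⁆).prod ^ k, x⁆ ∈ lcs G 2) :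
    grMk _ h = k • ∑ j, grBracket (i := 1) (j := 0)
      (grBracket (i := 0) (j := 0) (grMk (a j) (Subgroup.mem_top _))
        (grMk (b j) (Subgroup.mem_top _))) (grMk x (Subgroup.mem_top _)) := by
  have h1 := zpow_mem (list_prod_commutator_mem a b) k
  have e : grMk _ h = grBracketHom (i := 1) (j := 0) (grMk x (Subgroup.mem_top _))
      (grMk _ h1) := rfl
  rw [e, grMk_zpow (list_prod_commutator_mem a b), map_zsmul, grMk_list_prod_commutator, map_sum]
  rfl

end GradedArithmetic

/-! ### Detecting a triple commutator by unitriangular matrices -/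

section Unitriangular

/-- The matrices whose entries vanish below the `m`-th superdiagonal. -/
def Depth (m : ℕ) (A : Matrix (Fin 4) (Fin 4) ℤ) : Prop :=
  ∀ i j : Fin 4, (j : ℕ) < i + m → A i j = 0

theorem Depth.mono {m n : ℕ} (h : m ≤ n) {A : Matrix (Fin 4) (Fin 4) ℤ} (hA : Depth n A) :
    Depth m A := fun i j hij => hA i j (by omega)

theorem Depth.add {m : ℕ} {A C : Matrix (Fin 4) (Fin 4) ℤ} (hA : Depth m A) (hC : Depth m C) :
    Depth m (A + C) := fun i j hij => by
  rw [Matrix.add_apply, hA i j hij, hC i j hij, add_zero]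

theorem Depth.sub {m : ℕ} {A C : Matrix (Fin 4) (Fin 4) ℤ} (hA : Depth m A) (hC : Depth m C) :
    Depth m (A - C) := fun i j hij => by
  rw [Matrix.sub_apply, hA i j hij, hC i j hij, sub_zero]

theorem Depth.mul {m n : ℕ} {A C : Matrix (Fin 4) (Fin 4) ℤ} (hA : Depth m A) (hC : Depth n C) :
    Depth (m + n) (A * C) := fun i j hij => by
  rw [Matrix.mul_apply]
  refine Finset.sum_eq_zero fun k _ => ?_
  by_cases hk : (k : ℕ) < i + m
  · rw [hA i k hk, zero_mul]
  · rw [hC k j (by omega), mul_zero]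

theorem depth_one : Depth 0 1 := fun i j hij => Matrix.one_apply_ne (by omega)

/-- The group of unitriangular matrices that agree with the identity matrix below the `m`-th
superdiagonal. -/
def unitriangular (m : ℕ) : Subgroup (Matrix (Fin 4) (Fin 4) ℤ)ˣ where
  -- Imposing the condition on the inverse too makes closure under inversion immediate.
  carrier := {u | Depth m (u.val - 1) ∧ Depth m (u⁻¹.val - 1)}
  one_mem' := by
    have : Depth m 0 := fun _ _ _ => rfl
    simpa using this
  mul_mem' := by
    have key : ∀ A C : Matrix (Fin 4) (Fin 4) ℤ, Depth m (A - 1) → Depth m (C - 1) →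
        Depth m (A * C - 1) := by
      intro A C hA hC
      have e : A * C - 1 = (A - 1) * (C - 1) + (A - 1) + (C - 1) := by noncomm_ring
      rw [e]
      exact (((hA.mul hC).mono (by omega)).add hA).add hC
    rintro u v ⟨hu, hu'⟩ ⟨hv, hv'⟩
    refine ⟨key _ _ hu hv, ?_⟩
    rw [mul_inv_rev]
    exact key _ _ hv' hu'
  inv_mem' := by
    rintro u ⟨hu, hu'⟩
    exact ⟨hu', by rwa [inv_inv]⟩

theorem unitriangular_depth_zero {m : ℕ} {u : (Matrix (Fin 4) (Fin 4) ℤ)ˣ}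
    (hu : u ∈ unitriangular m) : Depth 0 u.val := by
  have := (hu.1.mono (Nat.zero_le m)).add depth_one
  rwa [sub_add_cancel] at this

/-- With `A = u - 1` and `C = v - 1` one has `⁅u, v⁆ - 1 = (A * C - C * A) * u⁻¹ * v⁻¹`, and depths
add under multiplication. The inverse of `⁅u, v⁆` is `⁅v, u⁆`, so the same formula covers it. -/
theorem commutator_mem_unitriangular {m n : ℕ} {u v : (Matrix (Fin 4) (Fin 4) ℤ)ˣ}
    (hu : u ∈ unitriangular m) (hv : v ∈ unitriangular n) : ⁅u, v⁆ ∈ unitriangular (m + n) := by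
  have key : ∀ {m n : ℕ} {u v : (Matrix (Fin 4) (Fin 4) ℤ)ˣ}, u ∈ unitriangular m →
      v ∈ unitriangular n → Depth (m + n) ((⁅u, v⁆ : (Matrix (Fin 4) (Fin 4) ℤ)ˣ).val - 1) := by
    intro m n u v hu hv
    have e : (⁅u, v⁆ : (Matrix (Fin 4) (Fin 4) ℤ)ˣ).val - 1 =
        ((u.val - 1) * (v.val - 1) - (v.val - 1) * (u.val - 1)) * (u⁻¹.val * v⁻¹.val) := by
      have e1 : (u.val - 1) * (v.val - 1) - (v.val - 1) * (u.val - 1) =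
          u.val * v.val - v.val * u.val := by noncomm_ring
      have e2 : v.val * u.val * (u⁻¹.val * v⁻¹.val) = 1 := by
        rw [← Units.val_mul, ← Units.val_mul, ← Units.val_mul, ← mul_inv_rev, mul_inv_cancel,
          Units.val_one]
      rw [e1, sub_mul, e2, commutatorElement_def]
      simp only [Units.val_mul, mul_assoc]
    rw [e]
    have h1 := (hu.1.mul hv.1).sub ((hv.1.mul hu.1).mono (by omega))
    exact (h1.mul ((unitriangular_depth_zero (inv_mem hu)).mul
      (unitriangular_depth_zero (inv_mem hv)))).mono (by omega)
  refine ⟨key hu hv, ?_⟩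
  rw [commutatorElement_inv, add_comm]
  exact key hv hu

theorem lcs_le_unitriangular {G : Type*} [Group G] (f : G →* (Matrix (Fin 4) (Fin 4) ℤ)ˣ)
    (hf : ∀ x, f x ∈ unitriangular 1) (n : ℕ) : lcs G n ≤ (unitriangular (n + 1)).comap f := by
  induction n with
  | zero => exact fun x _ => hf x
  | succ n ih =>
    refine Subgroup.commutator_le.2 fun x hx y _ => ?_
    rw [Subgroup.mem_comap, map_commutatorElement]
    exact commutator_mem_unitriangular (ih hx) (hf y)

/-- The corner entry, a homomorphism on the matrices that differ from the identity only there. -/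
def corner : unitriangular 3 →* Multiplicative ℤ where
  toFun u := Multiplicative.ofAdd (u.1.val 0 3)
  map_one' := rfl
  map_mul' := by
    intro u v
    have e : (u * v).1.val - 1 =
        (u.1.val - 1) * (v.1.val - 1) + (u.1.val - 1) + (v.1.val - 1) := by
      rw [Subgroup.coe_mul, Units.val_mul]; noncomm_ring
    have h := congrFun (congrFun e 0) 3
    -- The product has depth `6`, hence vanishes, so corner entries add.
    have h0 : ((u.1.val - 1) * (v.1.val - 1)) 0 3 = 0 :=
      (u.2.1.mul v.2.1) 0 3 (by decide)
    have h1 : (1 : Matrix (Fin 4) (Fin 4) ℤ) 0 3 = 0 := rfl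
    simp only [Matrix.add_apply, Matrix.sub_apply, h0, h1, sub_zero, zero_add] at h
    rw [← ofAdd_add, ← h]

/-- With `unitX = 1 + E₁₂ + E₂₃` and `unitY = 1 + E₃₄`, the leading terms are `[E₁₂ + E₂₃, E₃₄] =
E₂₄` and `[E₂₄, E₁₂ + E₂₃] = -E₁₄`, so the triple commutator survives in the corner. -/
def unitX : (Matrix (Fin 4) (Fin 4) ℤ)ˣ where
  val := !![1, 1, 0, 0; 0, 1, 1, 0; 0, 0, 1, 0; 0, 0, 0, 1]
  inv := !![1, -1, 1, 0; 0, 1, -1, 0; 0, 0, 1, 0; 0, 0, 0, 1]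
  val_inv := by decide
  inv_val := by decide

def unitY : (Matrix (Fin 4) (Fin 4) ℤ)ˣ where
  val := !![1, 0, 0, 0; 0, 1, 0, 0; 0, 0, 1, 1; 0, 0, 0, 1]
  inv := !![1, 0, 0, 0; 0, 1, 0, 0; 0, 0, 1, -1; 0, 0, 0, 1]
  val_inv := by decide
  inv_val := by decide

theorem unitX_mem : unitX ∈ unitriangular 1 := by
  constructor <;> intro i j hij <;> fin_cases i <;> fin_cases j <;>
    first | rfl | exact absurd hij (by decide)

theorem unitY_mem : unitY ∈ unitriangular 1 := by
  constructor <;> intro i j hij <;> fin_cases i <;> fin_cases j <;>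
    first | rfl | exact absurd hij (by decide)

theorem corner_triple : (⁅⁅unitX, unitY⁆, unitX⁆ : (Matrix (Fin 4) (Fin 4) ℤ)ˣ).val 0 3 ≠ 0 := by
  decide

variable {G : Type*} [Group G]

/-- If `a, b` is a free basis, then a nonzero power of `∏ ⁅aⱼ, bⱼ⁆` has a commutator with `a₀`
outside of the fourth term of the lower central series. -/
theorem commutator_zpow_notMem {g : ℕ} (hg : 1 ≤ g) (a b : Fin g → G)
    (h : Function.Bijective (FreeGroup.lift (Sum.elim a b))) {k : ℤ} (hk : k ≠ 0) :
    ⁅(List.ofFn fun j => ⁅a j, b j⁆).prod ^ k, a ⟨0, hg⟩⁆ ∉ lcs G 3 := by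
  intro hmem
  set e := MulEquiv.ofBijective _ h with he
  -- Only the first handle is kept: every other commutator in the product maps to `1`.
  set w : Fin g ⊕ Fin g → (Matrix (Fin 4) (Fin 4) ℤ)ˣ :=
    Sum.elim (fun j => if (j : ℕ) = 0 then unitX else 1) (fun j => if (j : ℕ) = 0 then unitY else 1)
    with hw
  set f : G →* (Matrix (Fin 4) (Fin 4) ℤ)ˣ := (FreeGroup.lift w).comp e.symm.toMonoidHom with hf
  have hgen : ∀ s, f (Sum.elim a b s) = w s := by
    intro s
    have : e.symm (Sum.elim a b s) = FreeGroup.of s := by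
      rw [MulEquiv.symm_apply_eq]; exact (FreeGroup.lift_apply_of).symm
    rw [hf, MonoidHom.comp_apply]
    exact (congrArg (FreeGroup.lift w) this).trans FreeGroup.lift_apply_of
  have ha : ∀ j, f (a j) = if (j : ℕ) = 0 then unitX else 1 := fun j => hgen (Sum.inl j)
  have hb : ∀ j, f (b j) = if (j : ℕ) = 0 then unitY else 1 := fun j => hgen (Sum.inr j)
  have hf1 : ∀ x, f x ∈ unitriangular 1 := by
    have hr : (FreeGroup.lift w).range ≤ unitriangular 1 := by
      refine FreeGroup.range_lift_le ?_
      rintro _ ⟨s | s, rfl⟩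
      · simp only [hw, Sum.elim_inl]; split_ifs
        exacts [unitX_mem, one_mem _]
      · simp only [hw, Sum.elim_inr]; split_ifs
        exacts [unitY_mem, one_mem _]
    exact fun x => hr ⟨_, rfl⟩
  obtain ⟨m, rfl⟩ : ∃ m, g = m + 1 := ⟨g - 1, by omega⟩
  set c := (List.ofFn fun j => ⁅a j, b j⁆).prod with hc
  have hfc : f c = ⁅unitX, unitY⁆ := by
    rw [hc, List.ofFn_succ, List.prod_cons, map_mul, map_commutatorElement, ha, hb]
    have : f (List.ofFn fun j : Fin m => ⁅a j.succ, b j.succ⁆).prod = 1 := by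
      rw [map_list_prod]
      refine List.prod_eq_one fun x hx => ?_
      obtain ⟨y, hy, rfl⟩ := List.mem_map.1 hx
      obtain ⟨j, rfl⟩ := List.mem_ofFn.1 hy
      rw [map_commutatorElement, ha, hb]
      simp
    rw [this]
    simp
  have hc1 : c ∈ lcs G 1 := list_prod_commutator_mem a b
  have hz : ⁅c, a ⟨0, hg⟩⁆ ∈ lcs G 2 := commutator_mem_lcs (j := 0) hc1 (Subgroup.mem_top _)
  have hzk : ⁅c ^ k, a ⟨0, hg⟩⁆ ∈ lcs G 2 := lcs_anti (by omega) hmem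
  -- Linearity turns membership of `⁅c ^ k, a₀⁆` in `γ 3` into membership of `⁅c, a₀⁆ ^ k`, to which
  -- the homomorphism `corner` applies.
  have hlin : grMk _ hzk = k • grMk _ hz := by
    have e1 : grMk _ hzk = grBracketHom (i := 1) (j := 0)
        (grMk (a ⟨0, hg⟩) (Subgroup.mem_top _)) (grMk _ (zpow_mem hc1 k)) := rfl
    rw [e1, grMk_zpow hc1, map_zsmul]
    rfl
  rw [(grMk_eq_zero_iff hzk).2 hmem, ← grMk_zpow, eq_comm, grMk_eq_zero_iff] at hlin
  -- Depth `4` leaves no room for nonzero entries, so the image of `⁅c, a₀⁆ ^ k` is the identity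
  -- matrix. Its corner entry is also `k` times that of `⁅⁅unitX, unitY⁆, unitX⁆`.
  have h4 := (lcs_le_unitriangular f hf1 3 hlin).1 0 3 (by decide)
  have h3 : f ⁅c, a ⟨0, hg⟩⁆ ∈ unitriangular 3 := lcs_le_unitriangular f hf1 2 hz
  have hcor := map_zpow corner ⟨_, h3⟩ k
  have hval : corner ⟨f ⁅c, a ⟨0, hg⟩⁆, h3⟩ =
      Multiplicative.ofAdd ((⁅⁅unitX, unitY⁆, unitX⁆ : (Matrix (Fin 4) (Fin 4) ℤ)ˣ).val 0 3) := by
    have : f ⁅c, a ⟨0, hg⟩⁆ = ⁅⁅unitX, unitY⁆, unitX⁆ := by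
      rw [map_commutatorElement, hfc, ha]; simp
    simp only [this]
    rfl
  have hpow : corner (⟨f ⁅c, a ⟨0, hg⟩⁆, h3⟩ ^ k) = 1 := by
    rw [Matrix.sub_apply, Matrix.one_apply_ne (by decide), sub_zero, map_zpow] at h4
    exact congrArg Multiplicative.ofAdd h4
  rw [hpow, hval, ← ofAdd_zsmul] at hcor
  have := congrArg Multiplicative.toAdd hcor
  simp only [toAdd_one, toAdd_ofAdd, smul_eq_mul] at this
  rcases mul_eq_zero.1 this.symm with h0 | h0
  · exact hk h0
  · exact corner_triple h0

end Unitriangular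

/-! ### Rotating a collar -/

section Spin

variable {M : Type} [TopologicalSpace M] {B : Set M}

namespace Collar

/-- Rotation of each circle `S¹ × {t}` by the angle `2 π α t`. -/
def rotBy (α : I → ℝ) (q : Circle × I) : Circle × I :=
  (q.1 * Circle.exp (2 * Real.pi * α q.2), q.2)

theorem rotBy_rotBy (α β : I → ℝ) (q : Circle × I) :
    rotBy α (rotBy β q) = rotBy (fun t => β t + α t) q := by
  refine Prod.ext ?_ rfl
  simp only [rotBy]
  rw [mul_assoc, ← Circle.exp_add, ← mul_add]

theorem rotBy_int (α : I → ℝ) (q : Circle × I) (k : ℤ) (h : α q.2 = k) : rotBy α q = q := by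
  refine Prod.ext ?_ rfl
  have : Circle.exp (2 * Real.pi * k) = 1 := by
    rw [Circle.exp_eq_one]; exact ⟨k, by ring⟩
  simp only [rotBy, h, this, mul_one]

variable (φ : Collar B)

open Classical in
/-- Rotation of the collar by `rotBy α`, extended by the identity. -/
def spin (α : I → ℝ) (x : M) : M :=
  if h : ∃ q, φ.toFun q = x then φ.toFun (rotBy α h.choose) else x

theorem spin_apply (α : I → ℝ) (q : Circle × I) :
    φ.spin α (φ.toFun q) = φ.toFun (rotBy α q) := by
  have h : ∃ q', φ.toFun q' = φ.toFun q := ⟨q, rfl⟩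
  rw [spin, dif_pos h, φ.isClosedEmbedding.injective h.choose_spec]

theorem spin_of_notMem (α : I → ℝ) {x : M} (hx : x ∉ Set.range φ.toFun) : φ.spin α x = x :=
  dif_neg hx

theorem spin_spin (α β : I → ℝ) (x : M) :
    φ.spin α (φ.spin β x) = φ.spin (fun t => β t + α t) x := by
  by_cases hr : x ∈ Set.range φ.toFun
  · obtain ⟨q, rfl⟩ := hr
    rw [spin_apply, spin_apply, spin_apply, rotBy_rotBy]
  · rw [φ.spin_of_notMem β hr, φ.spin_of_notMem α hr, φ.spin_of_notMem _ hr]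

theorem spin_int (k : ℤ) (x : M) : φ.spin (fun _ => k) x = x := by
  by_cases hr : x ∈ Set.range φ.toFun
  · obtain ⟨q, rfl⟩ := hr
    rw [spin_apply, rotBy_int _ q k rfl]
  · rw [φ.spin_of_notMem _ hr]

theorem spin_injective (α : I → ℝ) : Function.Injective (φ.spin α) := by
  have : Function.LeftInverse (φ.spin fun t => - α t) (φ.spin α) := by
    intro x
    rw [spin_spin]
    simpa using φ.spin_int 0 x
  exact this.injective

theorem spin_notMem (α : I → ℝ) {x : M} (hx : x ∉ B) : φ.spin α x ∉ B := by
  intro h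
  obtain ⟨⟨z, t⟩, ht, hq⟩ := φ.image_zero.superset h
  obtain rfl : t = 0 := ht
  have : x = φ.spin (fun t => - α t) (φ.toFun (z, 0)) := by
    rw [hq, spin_spin]
    simpa using (φ.spin_int 0 x).symm
  apply hx
  rw [this, spin_apply]
  exact φ.image_zero.subset ⟨_, rfl, rfl⟩

/-- A continuous family of rotations that are trivial at the inner end of the collar is
continuous. -/
theorem continuous_spin (α : I → I → ℝ) (hα : Continuous fun p : I × I => α p.1 p.2)
    (k : ℤ) (h1 : ∀ s, α s 1 = k) : Continuous fun p : I × M => φ.spin (α p.1) p.2 := by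
  -- Two closed pieces are glued: the collar, and the complement of its part `t < 1`. They overlap
  -- in the circle `t = 1`, where the rotation is by whole turns.
  have c1 : ContinuousOn (fun p : I × M => φ.spin (α p.1) p.2)
      (Set.univ ×ˢ Set.range φ.toFun) := by
    have e : Continuous fun p : I × (Circle × I) => φ.spin (α p.1) (φ.toFun p.2) := by
      simp only [spin_apply, rotBy]
      refine φ.isClosedEmbedding.continuous.comp (Continuous.prodMk
        (continuous_snd.fst.mul (Circle.exp.continuous.comp ?_)) continuous_snd.snd)
      exact continuous_const.mul (hα.comp (continuous_fst.prodMk continuous_snd.snd))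
    have hemb : Topology.IsClosedEmbedding (Prod.map id φ.toFun : I × (Circle × I) → I × M) :=
      Topology.IsClosedEmbedding.id.prodMap φ.isClosedEmbedding
    have hr : Set.range (Prod.map id φ.toFun : I × (Circle × I) → I × M) =
        Set.univ ×ˢ Set.range φ.toFun := by rw [Set.range_prodMap, Set.range_id]
    rw [← hr, continuousOn_iff_continuous_domRestrict]
    have q := hemb.isEmbedding.toHomeomorph.isQuotientMap
    rw [q.continuous_iff]
    exact e
  have c2 : ContinuousOn (fun p : I × M => φ.spin (α p.1) p.2)
      (Set.univ ×ˢ (φ.toFun '' {q | q.2 < 1})ᶜ) := by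
    refine continuous_snd.continuousOn.congr fun p hp => ?_
    have hx := hp.2
    by_cases hr : p.2 ∈ Set.range φ.toFun
    · obtain ⟨⟨z, t⟩, hzt⟩ := hr
      have ht : t = 1 := by
        by_contra hne
        exact hx ⟨(z, t), lt_of_le_of_ne unitInterval.le_one' hne, hzt⟩
      subst ht
      simp only [← hzt]
      rw [spin_apply, rotBy_int _ (z, 1) k (h1 p.1)]
    · exact φ.spin_of_notMem _ hr
  have c3 := c1.union_of_isClosed c2 (isClosed_univ.prod φ.isClosedEmbedding.isClosed_range)
    (isClosed_univ.prod φ.isOpen_image.isClosed_compl)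
  have h4 : Set.univ ×ˢ Set.range φ.toFun ∪ Set.univ ×ˢ (φ.toFun '' {q | q.2 < 1})ᶜ =
      (Set.univ : Set (I × M)) := by
    refine Set.eq_univ_of_forall fun x => ?_
    by_cases hr : x.2 ∈ Set.range φ.toFun
    · exact Or.inl ⟨trivial, hr⟩
    · exact Or.inr ⟨trivial, fun h => hr (Set.image_subset_range _ _ h)⟩
  rw [h4] at c3
  exact continuousOn_univ.1 c3

/-- The angle at time `s` of the isotopy from the identity to the boundary twist that rotates the
boundary once. -/
def untwistAngle (s t : I) : ℝ := -(1 - s * (1 - t))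

theorem continuous_untwist : Continuous fun p : I × M => φ.spin (untwistAngle p.1) p.2 := by
  refine φ.continuous_spin untwistAngle ?_ (-1) fun s => by simp [untwistAngle]
  unfold untwistAngle
  fun_prop

theorem untwist_zero (x : M) : φ.spin (untwistAngle 0) x = x := by
  have : untwistAngle 0 = fun _ => ((-1 : ℤ) : ℝ) := by
    funext t; simp [untwistAngle]
  rw [this, spin_int]

theorem untwist_one (x : M) : φ.spin (untwistAngle 1) x = (φ.twistHomeo : M ≃ₜ M) x := by
  change _ = φ.twistMap (-1) x
  by_cases hr : x ∈ Set.range φ.toFun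
  · obtain ⟨q, rfl⟩ := hr
    rw [spin_apply, twistMap_apply]
    refine congrArg φ.toFun (Prod.ext ?_ rfl)
    simp only [rotBy, rot, untwistAngle]
    congr 3
    simp
  · rw [φ.spin_of_notMem _ hr, φ.twistMap_of_notMem _ hr]

/-- The boundary twist acts trivially on the homology of configuration spaces. -/
theorem homologyAction_dehnTwist (n i : ℕ) : homologyAction n i φ.dehnTwist = 1 := by
  change homeoHomology n i φ.twistHomeo = 1
  rw [← map_one (homeoHomology (B := B) n i)]
  have H : TopCat.Homotopy (TopCat.ofHom (confMap n (1 : HomeoFix B)))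
      (TopCat.ofHom (confMap n φ.twistHomeo)) :=
    -- The homotopy need not fix `B` pointwise; it only has to be injective at each time and keep `M
    -- \ B` in itself.
    { toFun := fun q => ⟨fun j => φ.spin (untwistAngle q.1) (q.2.1 j),
        (φ.spin_injective _).comp q.2.2.1, fun j => φ.spin_notMem _ (q.2.2.2 j)⟩
      continuous_toFun := by
        refine Continuous.subtype_mk (continuous_pi fun j => ?_) _
        exact φ.continuous_untwist.comp (continuous_fst.prodMk
          ((continuous_apply j).comp (continuous_subtype_val.comp continuous_snd)))
      map_zero_left := by
        intro z; exact Subtype.ext (funext fun j => φ.untwist_zero _)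
      map_one_left := by
        intro z; exact Subtype.ext (funext fun j => φ.untwist_one _) }
  exact congrArg ModuleCat.Hom.hom
    (H.congr_homologyMap_singularChainComplexFunctor (ModuleCat.of ℤ ℤ) i).symm

/-- The boundary twist acts on the fundamental group as conjugation by the boundary class. -/
theorem piAction_dehnTwist (p : B) (x : FundamentalGroup M (p : M)) :
    piAction p φ.dehnTwist x = φ.boundaryClass p * x * (φ.boundaryClass p)⁻¹ := by
  rw [eq_mul_inv_iff_mul_eq]
  obtain ⟨γ, rfl⟩ : ∃ γ : Path (p : M) p, Path.Homotopic.Quotient.mk γ = x :=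
    Path.Homotopic.Quotient.mk_surjective x
  have hp : toMap φ.twistHomeo p = p := φ.twistHomeo.2 p p.2
  let H : (ContinuousMap.id M).Homotopy (toMap φ.twistHomeo) :=
    { toFun := fun q => φ.spin (untwistAngle q.1) q.2
      continuous_toFun := φ.continuous_untwist
      map_zero_left := φ.untwist_zero
      map_one_left := φ.untwist_one }
  obtain ⟨tr, htr⟩ : ∃ tr : Path (p : M) p, tr = (H.evalAt (p : M)).cast rfl hp.symm := ⟨_, rfl⟩
  have htr' : tr = φ.boundaryLoop p := by
    rw [htr]
    refine Path.ext (funext fun s => ?_)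
    change φ.spin (untwistAngle s) p = φ.toFun _
    conv_lhs => rw [← (φ.exists_angle p).choose_spec]
    rw [spin_apply]
    refine congrArg φ.toFun (Prod.ext ?_ rfl)
    simp only [rotBy, untwistAngle]
    congr 1
    -- At `t = 0` the isotopy has angle `2π(s - 1)`, the boundary loop `2πs`: they differ by a full
    -- turn.
    have : 2 * Real.pi * (s : ℝ) = 2 * Real.pi * -(1 - s * (1 - ((0 : I) : ℝ))) + 2 * Real.pi := by
      simp only [Set.Icc.coe_zero]; ring
    rw [this, Circle.exp_add, Circle.exp_two_pi, mul_one]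
  -- In `FundamentalGroup` the product `x * y` runs through `y` first, so this square reads `c * γ =
  -- T(γ) * c`.
  have key : (γ.trans tr).Homotopic
      (tr.trans ((γ.map (toMap φ.twistHomeo).continuous).cast hp.symm hp.symm)) := by
    rw [htr]; exact Path.Homotopic.map_trans_evalAt H γ
  rw [htr'] at key
  exact (congrArg (fun y : FundamentalGroup M (p : M) => y * φ.boundaryClass p)
    (homeoPi_mk p φ.twistHomeo γ)).trans (Path.Homotopic.Quotient.eq.2 key).symm

theorem piAction_dehnTwist_zpow (p : B) (k : ℤ) (x : FundamentalGroup M (p : M)) :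
    piAction p (φ.dehnTwist ^ k) x = φ.boundaryClass p ^ k * x * (φ.boundaryClass p ^ k)⁻¹ := by
  have hmul : ∀ (f h : MCG B) (x : FundamentalGroup M (p : M)),
      piAction p (f * h) x = piAction p f (piAction p h x) := fun f h x =>
    DFunLike.congr_fun (map_mul (piAction p) f h) x
  have hone : ∀ x : FundamentalGroup M (p : M), piAction p 1 x = x := fun x =>
    DFunLike.congr_fun (map_one (piAction p)) x
  have hpow : ∀ (n : ℕ) (x : FundamentalGroup M (p : M)), piAction p (φ.dehnTwist ^ n) x =
      φ.boundaryClass p ^ n * x * (φ.boundaryClass p ^ n)⁻¹ := by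
    intro n
    induction n with
    | zero => intro x; rw [pow_zero, pow_zero, hone, one_mul, inv_one, mul_one]
    | succ n ih =>
      intro x
      rw [pow_succ', hmul, ih, piAction_dehnTwist, pow_succ']
      group
  obtain ⟨n, rfl | rfl⟩ := k.eq_nat_or_neg
  · rw [zpow_natCast, zpow_natCast]; exact hpow n x
  -- The natural power is applied to the conjugate by `c ^ (-n)`, which it carries to `x`; applying
  -- the inverse power gives the claim.
  · have h := hpow n (φ.boundaryClass p ^ (-(n : ℤ)) * x * (φ.boundaryClass p ^ (-(n : ℤ)))⁻¹)
    have h2 : φ.boundaryClass p ^ n *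
        (φ.boundaryClass p ^ (-(n : ℤ)) * x * (φ.boundaryClass p ^ (-(n : ℤ)))⁻¹) *
        (φ.boundaryClass p ^ n)⁻¹ = x := by
      rw [zpow_neg, zpow_natCast]; group
    rw [h2] at h
    conv_lhs => rw [← h]
    rw [← hmul, zpow_neg, zpow_natCast, inv_mul_cancel, hone]

end Collar

end Spin

/-! ### A collar of the standard surface -/

section ModelCollar

/-- The projection of the annulus onto the standard surface. -/
def modelMk (g : ℕ) : Circle × I → Model g := Quot.mk (SurfaceRel g)

theorem isQuotientMap_modelMk (g : ℕ) : Topology.IsQuotientMap (modelMk g) :=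
  isQuotientMap_quot_mk (r := SurfaceRel g)

/-- All identifications take place in `S¹ × {1}`, so the map that collapses this circle to `none`
and is injective elsewhere descends to the quotient. -/
theorem model_mk_eq {g : ℕ} {x y : Circle × I} (hy : y.2 ≠ 1)
    (h : modelMk g x = modelMk g y) : x = y := by
  classical
  let f : Circle × I → Option (Circle × I) := fun q => if q.2 = 1 then none else some q
  have hf : ∀ a b, SurfaceRel g a b → f a = f b := by
    rintro _ _ (_ | _ | _) <;> simp [f]
  have h1 : f x = f y := congrArg (Quot.lift f hf : Model g → _) h
  simp only [f, if_neg hy] at h1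
  split_ifs at h1
  exact Option.some_injective _ h1

/-- Sets that avoid `S¹ × {1}` are saturated, so openness and closedness of their images can be
tested in the annulus. -/
theorem preimage_image_model_mk {g : ℕ} {S : Set (Circle × I)} (hS : ∀ q ∈ S, q.2 ≠ 1) :
    modelMk g ⁻¹' (modelMk g '' S) = S := by
  refine Set.Subset.antisymm ?_ (Set.subset_preimage_image _ _)
  rintro x ⟨y, hy, hxy⟩
  exact model_mk_eq (hS y hy) hxy.symm ▸ hy

/-- Multiplication by `1 / 2` on the second factor. -/
def halve (q : Circle × I) : Circle × I :=
  (q.1, ⟨(q.2 : ℝ) / 2, by have := q.2.2.1; positivity, by linarith [q.2.2.2]⟩)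

theorem continuous_halve : Continuous halve := by
  unfold halve
  fun_prop

theorem halve_injective : Function.Injective halve := by
  rintro ⟨z, s⟩ ⟨w, t⟩ h
  have h1 : z = w := congrArg Prod.fst h
  have h2 : (s : ℝ) / 2 = t / 2 := congrArg (fun q : Circle × I => (q.2 : ℝ)) h
  exact Prod.ext h1 (Subtype.ext (by linarith))

theorem halve_ne_one (q : Circle × I) : (halve q).2 ≠ 1 := by
  intro h
  have h2 : (q.2 : ℝ) / 2 = 1 := congrArg Subtype.val h
  linarith [q.2.2.2]

theorem halve_image : halve '' {q | q.2 < 1} = {q | (q.2 : ℝ) < 1 / 2} := by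
  ext q
  constructor
  · rintro ⟨q, hq, rfl⟩
    have : (q.2 : ℝ) < 1 := hq
    change (q.2 : ℝ) / 2 < 1 / 2
    linarith
  · intro hq
    have h : (q.2 : ℝ) < 1 / 2 := hq
    have h0 := q.2.2.1
    refine ⟨(q.1, ⟨2 * (q.2 : ℝ), by positivity, by linarith⟩), ?_, ?_⟩
    · change 2 * (q.2 : ℝ) < 1
      linarith
    · refine Prod.ext rfl (Subtype.ext ?_)
      change 2 * (q.2 : ℝ) / 2 = q.2
      ring

variable {M : Type} [TopologicalSpace M] {B : Set M}

/-- The collar `(z, t) ↦ [z, t / 2]` of the boundary of the standard surface, carried to `M`. -/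
def modelCollar {g : ℕ} (e : Model g ≃ₜ M) (he : e '' modelBoundary g = B) : Collar B where
  toFun q := e (modelMk g (halve q))
  isClosedEmbedding := by
    refine e.isClosedEmbedding.comp
      (Topology.IsClosedEmbedding.of_continuous_injective_isClosedMap
        ((isQuotientMap_modelMk g).continuous.comp continuous_halve)
        (fun x y h => halve_injective (model_mk_eq (halve_ne_one y) h)) fun C hC => ?_)
    change IsClosed ((modelMk g ∘ halve) '' C)
    rw [Set.image_comp]
    refine (isQuotientMap_modelMk g).isClosed_preimage.1 ?_
    rw [preimage_image_model_mk]
    · exact continuous_halve.isClosedMap C hC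
    · rintro _ ⟨q, _, rfl⟩; exact halve_ne_one q
  image_zero := by
    rw [← he]
    have h0 : ∀ z : Circle, halve (z, 0) = (z, 0) := fun z => Prod.ext rfl (Subtype.ext (by simp [halve]))
    ext x
    constructor
    · rintro ⟨⟨z, t⟩, ht, rfl⟩
      obtain rfl : t = 0 := ht
      exact ⟨_, ⟨z, congrArg (modelMk g) (h0 z)⟩, rfl⟩
    · rintro ⟨_, ⟨z, rfl⟩, rfl⟩
      exact ⟨(z, 0), rfl, show e (modelMk g (halve (z, 0))) = e (modelMk g (z, 0)) from congrArg (fun q => e (modelMk g q)) (h0 z)⟩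
  isOpen_image := by
    change IsOpen ((fun q => e ((modelMk g ∘ halve) q)) '' _)
    rw [← Set.image_image (g := e), Set.image_comp, halve_image]
    refine e.isOpenMap _ ((isQuotientMap_modelMk g).isOpen_preimage.1 ?_)
    rw [preimage_image_model_mk]
    · exact isOpen_lt (continuous_subtype_val.comp continuous_snd) continuous_const
    · intro q hq h1
      have : (q.2 : ℝ) < 1 / 2 := hq
      rw [h1] at this
      norm_num at this

theorem modelCollar_zero {g : ℕ} (e : Model g ≃ₜ M) (he : e '' modelBoundary g = B) (z : Circle) :
    (modelCollar e he).toFun (z, 0) = e (modelMk g (z, 0)) := by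
  have h0 : halve (z, 0) = (z, 0) := Prod.ext rfl (Subtype.ext (by simp [halve]))
  change e (modelMk g (halve (z, 0))) = _
  rw [h0]

end ModelCollar

/-! ### Path classes that come from a simply connected space -/

section Segments

variable {X Y Z : Type*} [TopologicalSpace X] [TopologicalSpace Y] [TopologicalSpace Z]
  [SimplyConnectedSpace Y] [SimplyConnectedSpace Z]

/-- The image under `F` of the unique class of paths from `a` to `b`. -/
def seg (F : C(Y, X)) (a b : Y) {x y : X} (ha : F a = x) (hb : F b = y) :
    Path.Homotopic.Quotient x y :=
  ((Path.Homotopic.Quotient.mk (PathConnectedSpace.somePath a b)).map F).cast ha.symm hb.symm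

theorem quotient_symm_trans {x y z : X} (γ : Path.Homotopic.Quotient x y)
    (δ : Path.Homotopic.Quotient y z) : (γ.trans δ).symm = δ.symm.trans γ.symm := by
  induction γ using Path.Homotopic.Quotient.ind with | _ γ
  induction δ using Path.Homotopic.Quotient.ind with | _ δ
  rw [← Path.Homotopic.Quotient.mk_trans, ← Path.Homotopic.Quotient.mk_symm, Path.trans_symm]
  rfl

theorem seg_eq_mk (F : C(Y, X)) {a b : Y} (p : Path a b) {x y : X} (ha : F a = x) (hb : F b = y) :
    seg F a b ha hb =
      Path.Homotopic.Quotient.mk ((p.map F.continuous).cast ha.symm hb.symm) := by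
  subst ha hb
  have : Path.Homotopic.Quotient.mk (PathConnectedSpace.somePath a b) =
      Path.Homotopic.Quotient.mk p :=
    Path.Homotopic.Quotient.eq.2 (SimplyConnectedSpace.paths_homotopic _ _)
  unfold seg
  rw [this]
  rfl

theorem seg_trans (F : C(Y, X)) (a b c : Y) {x y z : X} (ha : F a = x) (hb : F b = y)
    (hc : F c = z) : (seg F a b ha hb).trans (seg F b c hb hc) = seg F a c ha hc := by
  subst ha hb hc
  rw [seg_eq_mk F (PathConnectedSpace.somePath a b), seg_eq_mk F (PathConnectedSpace.somePath b c),
    seg_eq_mk F ((PathConnectedSpace.somePath a b).trans (PathConnectedSpace.somePath b c)),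
    Path.map_trans]
  rfl

theorem seg_self (F : C(Y, X)) (a : Y) {x : X} (ha : F a = x) :
    seg F a a ha ha = Path.Homotopic.Quotient.refl x := by
  subst ha
  rw [seg_eq_mk F (Path.refl a)]
  rfl

theorem seg_symm (F : C(Y, X)) (a b : Y) {x y : X} (ha : F a = x) (hb : F b = y) :
    (seg F a b ha hb).symm = seg F b a hb ha := by
  subst ha hb
  rw [seg_eq_mk F (PathConnectedSpace.somePath a b),
    seg_eq_mk F (PathConnectedSpace.somePath a b).symm, ← Path.Homotopic.Quotient.mk_symm]
  rfl

theorem seg_comp (F : C(Y, X)) (h : C(Z, Y)) (a b : Z) {x y : X} (ha : F (h a) = x)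
    (hb : F (h b) = y) : seg (F.comp h) a b ha hb = seg F (h a) (h b) ha hb := by
  rw [seg_eq_mk F ((PathConnectedSpace.somePath a b).map h.continuous),
    seg_eq_mk (F.comp h) (PathConnectedSpace.somePath a b)]
  rfl

/-- This is how identifications in the strip become relations between path classes: `h` and `h'`
parametrise two pieces that `F` glues together. -/
theorem seg_eq_seg (F : C(Y, X)) (h h' : C(Z, Y)) (hh : ∀ z, F (h z) = F (h' z)) (p q : Z)
    {a b a' b' : Y} (hpa : h p = a) (hqb : h q = b) (hpa' : h' p = a') (hqb' : h' q = b')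
    {x y : X} (ha : F a = x) (hb : F b = y) (ha' : F a' = x) (hb' : F b' = y) :
    seg F a b ha hb = seg F a' b' ha' hb' := by
  subst hpa hqb hpa' hqb'
  rw [← seg_comp F h p q ha hb, ← seg_comp F h' p q ha' hb']
  have : F.comp h = F.comp h' := ContinuousMap.ext hh
  congr 1

end Segments

instance : SimplyConnectedSpace (ℝ × I) :=
  have : ContractibleSpace I := (convex_Icc (0 : ℝ) 1).contractibleSpace ⟨0, by simp⟩
  inferInstance

instance : SimplyConnectedSpace I :=
  have : ContractibleSpace I := (convex_Icc (0 : ℝ) 1).contractibleSpace ⟨0, by simp⟩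
  inferInstance

/-! ### Polygonal parametrisations of a surface with one boundary component -/

/-- `Q` presents `X` as the quotient of the strip `ℝ × [0, 1]` by the translation by `4 g` and by
the identification of the arcs `[k, k + 1] × {1}` and `[k + 2, k + 3] × {1}`, with opposite
directions, for `k` congruent to `0` or `1` modulo `4`. -/
structure IsPolygonMap (g : ℕ) {X : Type} [TopologicalSpace X] (Q : C(ℝ × I, X)) : Prop where
  genus_pos : 1 ≤ g
  isQuotientMap : Topology.IsQuotientMap Q
  shift : ∀ (θ : ℝ) (t : I), Q (θ + 4 * g, t) = Q (θ, t)
  fold : ∀ (k : ℤ) (u : I), k % 4 = 0 ∨ k % 4 = 1 → Q (k + u, 1) = Q (k + 3 - u, 1)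
  factor : ∀ {Y : Type} (f : ℝ × I → Y), (∀ θ t, f (θ + 4 * g, t) = f (θ, t)) →
    (∀ (k : ℤ) (u : I), k % 4 = 0 ∨ k % 4 = 1 → f (k + u, 1) = f (k + 3 - u, 1)) →
    ∀ a b, Q a = Q b → f a = f b

/-- The polygonal parametrisation of a surface homeomorphic to the standard one. -/
def modelStrip {g : ℕ} {M : Type} [TopologicalSpace M] (e : Model g ≃ₜ M) : C(ℝ × I, M) where
  toFun a := e (modelMk g (Circle.exp (2 * Real.pi * (a.1 / (4 * g))), a.2))
  continuous_toFun := by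
    refine e.continuous.comp ((isQuotientMap_modelMk g).continuous.comp
      (Continuous.prodMk (Circle.exp.continuous.comp ?_) continuous_snd))
    fun_prop

theorem modelStrip_apply {g : ℕ} {M : Type} [TopologicalSpace M] (e : Model g ≃ₜ M) (a : ℝ × I) :
    modelStrip e a = e (modelMk g (Circle.exp (2 * Real.pi * (a.1 / (4 * g))), a.2)) := rfl

theorem apply_add_int_mul {Y : Type} {N : ℝ} {f : ℝ × I → Y}
    (h : ∀ θ t, f (θ + N, t) = f (θ, t)) (k : ℤ) (θ : ℝ) (t : I) :
    f (θ + k * N, t) = f (θ, t) := by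
  have hp : Function.Periodic (fun θ => f (θ, t)) N := fun θ => h θ t
  exact hp.int_mul k θ

theorem modelStrip_shift {g : ℕ} (hg : 1 ≤ g) {M : Type} [TopologicalSpace M]
    (e : Model g ≃ₜ M) (θ : ℝ) (t : I) :
    modelStrip e (θ + 4 * g, t) = modelStrip e (θ, t) := by
  have hg0 : (g : ℝ) ≠ 0 := by positivity
  rw [modelStrip_apply, modelStrip_apply]
  have : 2 * Real.pi * ((θ + 4 * g) / (4 * g)) = 2 * Real.pi * (θ / (4 * g)) + 2 * Real.pi := by
    field_simp
  simp only [this, Circle.exp_add, Circle.exp_two_pi, mul_one]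

/-- The angle is rescaled so that each side of the polygon has length `1` and the vertices are the
integers. -/
theorem isPolygonMap_modelStrip {g : ℕ} (hg : 1 ≤ g) {M : Type} [TopologicalSpace M]
    (e : Model g ≃ₜ M) : IsPolygonMap g (modelStrip e) where
  genus_pos := hg
  isQuotientMap := by
    have hg0 : (g : ℝ) ≠ 0 := by positivity
    -- Openness is needed because the product of a general quotient map with the identity of `I`
    -- need not be handled separately: open quotient maps are stable under products.
    have hE : IsOpenQuotientMap fun θ : ℝ => Circle.exp (2 * Real.pi * (θ / (4 * g))) := by
      have h1 : IsOpenQuotientMap Circle.exp :=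
        ⟨Circle.exp_surjective, Circle.exp.continuous, Circle.isCoveringMap_exp.isOpenMap⟩
      have h2 : (fun θ : ℝ => Circle.exp (2 * Real.pi * (θ / (4 * g)))) =
          Circle.exp ∘ Homeomorph.mulRight₀ (2 * Real.pi / (4 * g)) (by positivity) := by
        funext θ
        simp only [Function.comp_apply, Homeomorph.coe_mulRight₀]
        congr 1; ring
      rw [h2]
      exact h1.comp (Homeomorph.isOpenQuotientMap _)
    exact e.isQuotientMap.comp ((isQuotientMap_modelMk g).comp
      (hE.prodMap IsOpenQuotientMap.id).isQuotientMap)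
  shift := modelStrip_shift hg e
  fold := by
    intro k u hk
    have hg0 : (g : ℝ) ≠ 0 := by positivity
    have hper : ∀ θ t, modelStrip e (θ + 4 * g, t) = modelStrip e (θ, t) := modelStrip_shift hg e
    obtain ⟨i, r, m, hi, hr, rfl⟩ : ∃ (i r : ℕ) (m : ℤ), i < g ∧ (r = 0 ∨ r = 1) ∧
        k = 4 * i + r + m * (4 * g) := by
      have h1 := Int.emod_nonneg (k / 4) (by omega : (g : ℤ) ≠ 0)
      have h2 := Int.emod_lt_of_pos (k / 4) (by omega : (0 : ℤ) < g)
      have h3 := Int.emod_add_mul_ediv (k / 4) g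
      have h4 := Int.emod_add_mul_ediv k 4
      refine ⟨((k / 4) % g).toNat, (k % 4).toNat, k / 4 / g, by omega, by omega, ?_⟩
      rw [Int.toNat_of_nonneg h1, Int.toNat_of_nonneg (by omega)]
      linear_combination -h4 - 4 * h3
    have e1 : (((4 * i + r + m * (4 * g) : ℤ) : ℝ) + u) = (4 * i + r + u) + m * (4 * g) := by
      push_cast; ring
    have e2 : (((4 * i + r + m * (4 * g) : ℤ) : ℝ) + 3 - u) =
        (4 * i + r + 3 - u) + m * (4 * g) := by
      push_cast; ring
    rw [e1, e2, apply_add_int_mul hper, apply_add_int_mul hper, modelStrip_apply, modelStrip_apply]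
    refine congrArg e ?_
    rcases hr with rfl | rfl
    · refine Eq.trans (Eq.trans ?_ (Quot.sound (SurfaceRel.a i hi u))) ?_
      · simp only [Nat.cast_zero, add_zero]; rfl
      · simp only [Nat.cast_zero, add_zero]; rfl
    · refine Eq.trans (Eq.trans ?_ (Quot.sound (SurfaceRel.b i hi u))) ?_
      · simp only [Nat.cast_one]; rfl
      · have : (4 * (i : ℝ) + (1 : ℕ) + 3 - u) = 4 * i + 4 - u := by push_cast; ring
        rw [this]; rfl
  factor := by
    intro Y f hs hf a b hab
    have hg0 : (g : ℝ) ≠ 0 := by positivity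
    -- The argument of a complex number serves as one choice of lift of the angle; periodicity of
    -- `f` makes the choice irrelevant.
    let F : Circle × I → Y := fun q => f (Complex.arg q.1 * (4 * g) / (2 * Real.pi), q.2)
    have hF : ∀ θ t, F (Circle.exp (2 * Real.pi * (θ / (4 * g))), t) = f (θ, t) := by
      intro θ t
      have h1 : Circle.exp (Complex.arg (Circle.exp (2 * Real.pi * (θ / (4 * g))))) =
          Circle.exp (2 * Real.pi * (θ / (4 * g))) := Circle.exp_arg _
      obtain ⟨m, hm⟩ := Circle.exp_eq_exp.1 h1
      change f (_, t) = _
      rw [hm, ← apply_add_int_mul hs m θ t]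
      congr 2
      field_simp
    have hrel : ∀ x y, SurfaceRel g x y → F x = F y := by
      rintro _ _ (⟨i, hi, u⟩ | ⟨i, hi, u⟩ | h0)
      · rw [hF, hF]
        have := hf (4 * i) u (Or.inl (by omega))
        push_cast at this
        exact this
      · rw [hF, hF]
        have := hf (4 * i + 1) u (Or.inr (by omega))
        push_cast at this
        rw [this]
        congr 2; ring
      · omega
    have h2 := congrArg (Quot.lift F hrel : Model g → Y) (e.injective hab)
    have h3 : F (Circle.exp (2 * Real.pi * (a.1 / (4 * g))), a.2) =
      F (Circle.exp (2 * Real.pi * (b.1 / (4 * g))), b.2) := h2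
    rwa [hF, hF] at h3

namespace IsPolygonMap

variable {g : ℕ} {X : Type} [TopologicalSpace X] {Q : C(ℝ × I, X)} (hQ : IsPolygonMap g Q)
include hQ

theorem shift_int (k : ℤ) (θ : ℝ) (t : I) : Q (θ + k * (4 * g), t) = Q (θ, t) :=
  apply_add_int_mul hQ.shift k θ t

/-- The ends `u = 0` and `u = 1` of a folded arc link vertex `k` to `k + 3` and `k + 1` to `k + 2`.
For `k = 4i` and `k = 4i + 1` together these links connect all of `4i, …, 4i + 4`. -/
theorem vertex_succ (k : ℤ) : Q ((k + 1 : ℤ), 1) = Q (k, 1) := by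
  have f0 : ∀ k : ℤ, k % 4 = 0 ∨ k % 4 = 1 → Q (k, 1) = Q ((k + 3 : ℤ), 1) := by
    intro k hk
    simpa using hQ.fold k 0 hk
  have f1 : ∀ k : ℤ, k % 4 = 0 ∨ k % 4 = 1 → Q ((k + 1 : ℤ), 1) = Q ((k + 2 : ℤ), 1) := by
    intro k hk
    have h := hQ.fold k 1 hk
    have e : (k : ℝ) + 3 - ((1 : I) : ℝ) = ((k + 2 : ℤ) : ℝ) := by rw [Set.Icc.coe_one]; push_cast; ring
    rw [e] at h
    simpa using h
  have h : k % 4 = 0 ∨ k % 4 = 1 ∨ k % 4 = 2 ∨ k % 4 = 3 := by omega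
  rcases h with h | h | h | h
  · have a := f0 k (Or.inl h)
    have b := f1 k (Or.inl h)
    have c := f1 (k + 1) (Or.inr (by omega))
    rw [show k + 1 + 1 = k + 2 by ring, show k + 1 + 2 = k + 3 by ring] at c
    rw [b, c, a]
  · have b := f1 (k - 1) (Or.inl (by omega))
    rw [show k - 1 + 1 = k by ring, show k - 1 + 2 = k + 1 by ring] at b
    exact b.symm
  · have b := f1 (k - 1) (Or.inr (by omega))
    rw [show k - 1 + 1 = k by ring, show k - 1 + 2 = k + 1 by ring] at b
    exact b.symm
  · have a := f0 (k - 3) (Or.inl (by omega))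
    have b := f1 (k - 3) (Or.inl (by omega))
    have c := f1 (k - 2) (Or.inr (by omega))
    have d := f0 (k - 2) (Or.inr (by omega))
    rw [show k - 3 + 3 = k by ring] at a
    rw [show k - 3 + 1 = k - 2 by ring, show k - 3 + 2 = k - 1 by ring] at b
    rw [show k - 2 + 1 = k - 1 by ring, show k - 2 + 2 = k by ring] at c
    rw [show k - 2 + 3 = k + 1 by ring] at d
    rw [← d, b, c]

theorem vertex (k : ℤ) : Q (k, 1) = Q (0, 1) := by
  induction k using Int.induction_on with
  | zero => simp
  | succ k ih => rw [hQ.vertex_succ]; exact ih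
  | pred k ih => rw [← hQ.vertex_succ, sub_add_cancel]; exact ih

/-- The class of the path in the surface given by the `k`-th arc. -/
def arc (k : ℤ) : FundamentalGroup X (Q (0, 1)) :=
  seg Q ((k : ℝ), (1 : I)) (((k + 1 : ℤ) : ℝ), (1 : I)) (hQ.vertex k) (hQ.vertex (k + 1))

theorem seg_shift {a b a' b' : ℝ × I} (ha1 : a' = (a.1 + 4 * g, a.2))
    (hb1 : b' = (b.1 + 4 * g, b.2)) {x y : X} (ha : Q a = x) (hb : Q b = y)
    (ha' : Q a' = x) (hb' : Q b' = y) : seg Q a' b' ha' hb' = seg Q a b ha hb :=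
  seg_eq_seg Q ⟨fun a : ℝ × I => (a.1 + 4 * g, a.2), by fun_prop⟩ (ContinuousMap.id _)
    (fun a => hQ.shift a.1 a.2) a b ha1.symm hb1.symm rfl rfl ha' hb' ha hb

theorem seg_fold (k : ℤ) (hk : k % 4 = 0 ∨ k % 4 = 1) (u u' : I) {a b a' b' : ℝ × I}
    (ha1 : a = ((k : ℝ) + u, 1)) (hb1 : b = ((k : ℝ) + u', 1))
    (ha1' : a' = ((k : ℝ) + 3 - u, 1))
    (hb1' : b' = ((k : ℝ) + 3 - u', 1)) {x y : X} (ha : Q a = x) (hb : Q b = y)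
    (ha' : Q a' = x) (hb' : Q b' = y) : seg Q a b ha hb = seg Q a' b' ha' hb' :=
  seg_eq_seg Q ⟨fun v : I => ((k : ℝ) + v, (1 : I)), by fun_prop⟩
    ⟨fun v : I => ((k : ℝ) + 3 - v, (1 : I)), by fun_prop⟩
    (fun v => hQ.fold k v hk) u u' ha1.symm hb1.symm ha1'.symm hb1'.symm ha hb ha' hb'

theorem arc_add_two (k : ℤ) (hk : k % 4 = 0 ∨ k % 4 = 1) : hQ.arc (k + 2) = (hQ.arc k)⁻¹ := by
  have key : hQ.arc k = seg Q (((k + 2 + 1 : ℤ) : ℝ), (1 : I)) (((k + 2 : ℤ) : ℝ), (1 : I))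
      (hQ.vertex _) (hQ.vertex _) := by
    refine hQ.seg_fold k hk 0 1 ?_ ?_ ?_ ?_ _ _ _ _
    · simp
    · simp
    · refine Prod.ext ?_ rfl
      simp only [Set.Icc.coe_zero]; push_cast; ring
    · refine Prod.ext ?_ rfl
      simp only [Set.Icc.coe_one]; push_cast; ring
  rw [key]
  exact (seg_symm Q _ _ _ _).symm

/-- The class of the path that runs through the first arcs up to the `k`-th vertex. -/
def arcs (k : ℤ) : FundamentalGroup X (Q (0, 1)) :=
  seg Q ((0 : ℝ), (1 : I)) ((k : ℝ), (1 : I)) rfl (hQ.vertex k)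

theorem arcs_zero : hQ.arcs 0 = 1 := by
  refine Eq.trans ?_ (seg_self Q ((0 : ℝ), (1 : I)) rfl)
  exact seg_eq_seg Q (ContinuousMap.id _) (ContinuousMap.id _) (fun _ => rfl) _ _ rfl rfl rfl
    (by simp) _ _ _ _

theorem arcs_succ (k : ℤ) : hQ.arcs (k + 1) = hQ.arc k * hQ.arcs k :=
  (seg_trans Q _ _ _ _ _ _).symm

theorem arcs_mem {H : Subgroup (FundamentalGroup X (Q (0, 1)))} (hH : ∀ k, hQ.arc k ∈ H) (k : ℤ) :
    hQ.arcs k ∈ H := by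
  induction k using Int.induction_on with
  | zero => rw [arcs_zero]; exact one_mem _
  | succ k ih => rw [arcs_succ]; exact mul_mem (hH _) ih
  | pred k ih =>
    have h := hQ.arcs_succ (-(k : ℤ) - 1)
    rw [sub_add_cancel] at h
    rw [h] at ih
    exact (Subgroup.mul_mem_cancel_left _ (hH _)).1 ih

/-- The last two arcs of a block are the inverses of the first two, and later arcs stand further to
the left in the product. Each block thus contributes `⁅y⁻¹, x⁻¹⁆`, where `x` and `y` are its first
two arcs. -/
theorem arcs_four_mul (i : ℕ) : hQ.arcs (4 * (i + 1 : ℕ)) =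
    ((hQ.arc (4 * i + 1))⁻¹ * (hQ.arc (4 * i))⁻¹ * hQ.arc (4 * i + 1) * hQ.arc (4 * i)) *
      hQ.arcs (4 * i) := by
  have e : (4 * (i + 1 : ℕ) : ℤ) = 4 * i + 1 + 1 + 1 + 1 := by push_cast; ring
  rw [e, arcs_succ, arcs_succ, arcs_succ, arcs_succ,
    show (4 * i + 1 + 1 : ℤ) = 4 * i + 2 by ring, show (4 * i + 2 + 1 : ℤ) = 4 * i + 1 + 2 by ring,
    hQ.arc_add_two (4 * i) (by omega), hQ.arc_add_two (4 * i + 1) (by omega)]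
  simp only [mul_assoc]

/-! ### Generation by the arcs -/

omit hQ

/-- The loop class `γ` at the vertex represents an element of `H`. -/
def InSubgroup (H : Subgroup (FundamentalGroup X (Q (0, 1))))
    (γ : Path.Homotopic.Quotient (Q (0, 1)) (Q (0, 1))) : Prop :=
  (γ : FundamentalGroup X (Q (0, 1))) ∈ H

variable {H : Subgroup (FundamentalGroup X (Q (0, 1)))}

theorem InSubgroup.refl : InSubgroup H (Path.Homotopic.Quotient.refl (Q (0, 1))) := H.one_mem

theorem InSubgroup.trans {γ δ : Path.Homotopic.Quotient (Q (0, 1)) (Q (0, 1))}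
    (hγ : InSubgroup H γ) (hδ : InSubgroup H δ) : InSubgroup H (γ.trans δ) := H.mul_mem hδ hγ

theorem InSubgroup.symm {γ : Path.Homotopic.Quotient (Q (0, 1)) (Q (0, 1))}
    (hγ : InSubgroup H γ) : InSubgroup H γ.symm := H.inv_mem hγ

/-- The class of the loop at the vertex that consists of a path inside of the strip, the path `γ`
and a path inside of the strip. -/
def closeUp {x y : X} (γ : Path.Homotopic.Quotient x y) {a b : ℝ × I} (ha : Q a = x)
    (hb : Q b = y) : Path.Homotopic.Quotient (Q (0, 1)) (Q (0, 1)) :=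
  ((seg Q ((0 : ℝ), (1 : I)) a rfl ha).trans γ).trans (seg Q b ((0 : ℝ), (1 : I)) hb rfl)

theorem closeUp_trans {x y z : X} (γ : Path.Homotopic.Quotient x y)
    (δ : Path.Homotopic.Quotient y z) {a b c : ℝ × I} (ha : Q a = x) (hb : Q b = y)
    (hc : Q c = z) : (closeUp γ ha hb).trans (closeUp δ hb hc) = closeUp (γ.trans δ) ha hc := by
  have h1 := seg_trans Q b ((0 : ℝ), (1 : I)) b hb rfl hb
  rw [seg_self] at h1
  simp only [closeUp, Path.Homotopic.Quotient.trans_assoc]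
  rw [← Path.Homotopic.Quotient.trans_assoc (seg Q b _ hb rfl), h1,
    Path.Homotopic.Quotient.refl_trans]

theorem closeUp_symm {x y : X} (γ : Path.Homotopic.Quotient x y) {a b : ℝ × I} (ha : Q a = x)
    (hb : Q b = y) : (closeUp γ ha hb).symm = closeUp γ.symm hb ha := by
  unfold closeUp
  rw [quotient_symm_trans, quotient_symm_trans, seg_symm, seg_symm,
    Path.Homotopic.Quotient.trans_assoc]

/-- The path classes that become elements of `H` when their ends are joined to the vertex inside
of the strip. -/
def Good (H : Subgroup (FundamentalGroup X (Q (0, 1)))) {x y : X}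
    (γ : Path.Homotopic.Quotient x y) : Prop :=
  ∀ (a b : ℝ × I) (ha : Q a = x) (hb : Q b = y), InSubgroup H (closeUp γ ha hb)

theorem Good.symm {x y : X} {γ : Path.Homotopic.Quotient x y} (hγ : Good H γ) :
    Good H γ.symm := by
  intro a b ha hb
  rw [← closeUp_symm]
  exact (hγ b a hb ha).symm

/-- Good loops at the vertex represent elements of `H`. -/
theorem Good.mem {γ : Path.Homotopic.Quotient (Q (0, 1)) (Q (0, 1))} (h : Good H γ) :
    (γ : FundamentalGroup X (Q (0, 1))) ∈ H := by
  have h2 := h (0, 1) (0, 1) rfl rfl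
  rwa [closeUp, seg_self, Path.Homotopic.Quotient.refl_trans,
    Path.Homotopic.Quotient.trans_refl] at h2

include hQ

theorem good_trans {x y z : X} {γ : Path.Homotopic.Quotient x y}
    {δ : Path.Homotopic.Quotient y z} (hγ : Good H γ) (hδ : Good H δ) : Good H (γ.trans δ) := by
  intro a c ha hc
  obtain ⟨b, hb⟩ := hQ.isQuotientMap.surjective y
  rw [← closeUp_trans γ δ ha hb hc]
  exact (hγ a b ha hb).trans (hδ b c hb hc)

/-- The choice of lift of a point does not matter modulo `H`. Pairs of lifts whose closing loop lies
in `H` form an equivalence relation. It contains the shifts, with loop `arcs (4 * g)`, and the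
folds, with loop `arcs k` followed by the reverse of `arcs (k + 3)`; by `factor` it then contains
all pairs with the same image. -/
theorem good_refl (hH : ∀ k, hQ.arc k ∈ H) (x : X) : Good H (Path.Homotopic.Quotient.refl x) := by
  let r : ℝ × I → ℝ × I → Prop := fun a b => ∃ (x : X) (ha : Q a = x) (hb : Q b = x),
    InSubgroup H (closeUp (Path.Homotopic.Quotient.refl x) ha hb)
  have hr : Equivalence r := by
    refine ⟨fun a => ⟨_, rfl, rfl, ?_⟩, ?_, ?_⟩
    · rw [closeUp, Path.Homotopic.Quotient.trans_refl, seg_trans, seg_self]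
      exact InSubgroup.refl
    · rintro a b ⟨x, ha, hb, h⟩
      refine ⟨x, hb, ha, ?_⟩
      have h2 := h.symm
      rw [closeUp_symm] at h2
      exact h2
    · rintro a b c ⟨x, ha, hb, h⟩ ⟨y, hb', hc, h'⟩
      obtain rfl : x = y := hb.symm.trans hb'
      refine ⟨x, ha, hc, ?_⟩
      have h2 := h.trans h'
      rwa [closeUp_trans, Path.Homotopic.Quotient.trans_refl] at h2
  let S : Setoid (ℝ × I) := ⟨r, hr⟩
  have key : ∀ a b, Q a = Q b → r a b := by
    intro a b hab
    refine Quotient.exact (s := S) (hQ.factor (Quotient.mk S) ?_ ?_ a b hab)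
    · intro θ t
      refine Quotient.sound ⟨Q (θ, t), hQ.shift θ t, rfl, ?_⟩
      have e : (((4 * g : ℤ) : ℝ), (1 : I)) = ((0 : ℝ) + 4 * g, (1 : I)) := by simp
      rw [closeUp, Path.Homotopic.Quotient.trans_refl,
        ← seg_trans Q ((0 : ℝ), (1 : I)) (((4 * g : ℤ) : ℝ), (1 : I)) _ rfl (hQ.vertex _),
        hQ.seg_shift (a := ((0 : ℝ), (1 : I))) (b := (θ, t)) e rfl rfl rfl,
        Path.Homotopic.Quotient.trans_assoc, seg_trans, seg_self,
        Path.Homotopic.Quotient.trans_refl]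
      exact hQ.arcs_mem hH (4 * g)
    · intro k u hk
      refine Quotient.sound ⟨Q (k + u, 1), rfl, (hQ.fold k u hk).symm, ?_⟩
      rw [closeUp, Path.Homotopic.Quotient.trans_refl,
        ← seg_trans Q ((0 : ℝ), (1 : I)) ((k : ℝ), (1 : I)) _ rfl (hQ.vertex _),
        hQ.seg_fold k hk 0 u (b := ((k : ℝ) + u, (1 : I))) (a' := (((k + 3 : ℤ) : ℝ), (1 : I)))
          (by simp) rfl (by simp) rfl _ _ (hQ.vertex _) (hQ.fold k u hk).symm,
        Path.Homotopic.Quotient.trans_assoc, seg_trans]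
      refine InSubgroup.trans (hQ.arcs_mem hH k) ?_
      rw [← seg_symm Q _ _ rfl]
      exact InSubgroup.symm (hQ.arcs_mem hH (k + 3))
  intro a b ha hb
  obtain ⟨y, ha', hb', h⟩ := key a b (ha.trans hb.symm)
  subst ha
  subst ha'
  exact h

/-- Path classes coming from the strip are good. -/
theorem good_seg (hH : ∀ k, hQ.arc k ∈ H) (a b : ℝ × I) {x y : X} (ha : Q a = x) (hb : Q b = y) :
    Good H (seg Q a b ha hb) := by
  intro a' b' ha' hb'
  have h : InSubgroup H (closeUp (seg Q a b ha hb) ha hb) := by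
    rw [closeUp, seg_trans, seg_trans, seg_self]
    exact InSubgroup.refl
  have h2 := ((hQ.good_refl hH x a' a ha' ha).trans h).trans (hQ.good_refl hH y b b' hb hb')
  rwa [closeUp_trans, closeUp_trans, Path.Homotopic.Quotient.trans_refl,
    Path.Homotopic.Quotient.refl_trans] at h2

end IsPolygonMap

/-! ### Coordinates on the arcs -/

section ArcCoordinates

/-- The position of `θ` on its arc, where the arcs number `2` and `3` modulo `4` are read
backwards. -/
def arcPos (θ : ℝ) : ℝ :=
  if Int.fract θ = 0 then 0 else if ⌊θ⌋ % 4 < 2 then Int.fract θ else 1 - Int.fract θ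

/-- The number of the arc that contains `θ`, where identified arcs have the same number. -/
def arcLabel (g : ℕ) (θ : ℝ) : ℤ :=
  if Int.fract θ = 0 then 0 else if ⌊θ⌋ % 4 < 2 then ⌊θ⌋ % (4 * g) else (⌊θ⌋ - 2) % (4 * g)

theorem floor_fract_add {u : ℝ} (k : ℤ) (h0 : 0 < u) (h1 : u < 1) :
    ⌊(k : ℝ) + u⌋ = k ∧ Int.fract ((k : ℝ) + u) = u := by
  have h : ⌊(k : ℝ) + u⌋ = k := Int.floor_eq_iff.2 ⟨by linarith, by linarith⟩
  exact ⟨h, by rw [Int.fract, h]; ring⟩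

theorem arcPos_add {u : ℝ} (k : ℤ) (h0 : 0 < u) (h1 : u < 1) :
    arcPos (k + u) = if k % 4 < 2 then u else 1 - u := by
  obtain ⟨h, h'⟩ := floor_fract_add k h0 h1
  rw [arcPos, h, h', if_neg h0.ne']

theorem arcLabel_add (g : ℕ) {u : ℝ} (k : ℤ) (h0 : 0 < u) (h1 : u < 1) :
    arcLabel g (k + u) = if k % 4 < 2 then k % (4 * g) else (k - 2) % (4 * g) := by
  obtain ⟨h, h'⟩ := floor_fract_add k h0 h1
  rw [arcLabel, h, h', if_neg h0.ne']

theorem eq_zero_or_one_or_mem (u : I) : (u : ℝ) = 0 ∨ (u : ℝ) = 1 ∨ (0 < (u : ℝ) ∧ (u : ℝ) < 1) := by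
  rcases u.2.1.eq_or_lt with h | h
  · exact Or.inl h.symm
  · rcases u.2.2.eq_or_lt with h' | h'
    · exact Or.inr (Or.inl h')
    · exact Or.inr (Or.inr ⟨h, h'⟩)

/-- A function that is constant on the vertices needs checking only inside the arcs, where `k + 3 -
u` is the point `1 - u` of arc `k + 2`. -/
theorem fold_eq_of_interior {Y : Type*} (f : ℝ → Y) (y : Y) (hy : ∀ k : ℤ, f k = y)
    (h : ∀ (k : ℤ) (u : ℝ), 0 < u → u < 1 → k % 4 = 0 ∨ k % 4 = 1 →
      f (k + u) = f ((k + 2 : ℤ) + (1 - u)))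
    (k : ℤ) (u : I) (hk : k % 4 = 0 ∨ k % 4 = 1) : f (k + u) = f (k + 3 - u) := by
  rcases eq_zero_or_one_or_mem u with h0 | h0 | ⟨h0, h1⟩
  · have e : (k : ℝ) + 3 - 0 = ((k + 3 : ℤ) : ℝ) := by push_cast; ring
    rw [h0, e, add_zero, hy, hy]
  · have e : (k : ℝ) + 3 - 1 = ((k + 2 : ℤ) : ℝ) := by push_cast; ring
    have e' : (k : ℝ) + 1 = ((k + 1 : ℤ) : ℝ) := by push_cast; ring
    rw [h0, e, e', hy, hy]
  · rw [h k u h0 h1 hk]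
    congr 1; push_cast; ring

theorem arcPos_shift (g : ℕ) (θ : ℝ) : arcPos (θ + 4 * g) = arcPos θ := by
  have e : (4 * g : ℝ) = ((4 * g : ℤ) : ℝ) := by push_cast; ring
  have h : (⌊θ⌋ + 4 * g) % 4 = ⌊θ⌋ % 4 := by omega
  simp only [arcPos, e, Int.fract_add_intCast, Int.floor_add_intCast, h]

theorem arcLabel_shift (g : ℕ) (θ : ℝ) : arcLabel g (θ + 4 * g) = arcLabel g θ := by
  have e : (4 * g : ℝ) = ((4 * g : ℤ) : ℝ) := by push_cast; ring
  have h : (⌊θ⌋ + 4 * g) % 4 = ⌊θ⌋ % 4 := by omega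
  have h' : (⌊θ⌋ + 4 * g - 2) % (4 * g) = (⌊θ⌋ - 2) % (4 * g) := by
    rw [show ⌊θ⌋ + 4 * g - 2 = ⌊θ⌋ - 2 + 4 * g by ring, Int.add_emod_right]
  simp only [arcLabel, e, Int.fract_add_intCast, Int.floor_add_intCast, h, h', Int.add_emod_right]

theorem arcPos_intCast (k : ℤ) : arcPos k = 0 := by simp [arcPos]

theorem arcLabel_intCast (g : ℕ) (k : ℤ) : arcLabel g k = 0 := by simp [arcLabel]

theorem arcPos_fold (k : ℤ) (u : I) (hk : k % 4 = 0 ∨ k % 4 = 1) :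
    arcPos (k + u) = arcPos (k + 3 - u) := by
  refine fold_eq_of_interior arcPos 0 arcPos_intCast ?_ k u hk
  intro k u h0 h1 hk
  rw [arcPos_add k h0 h1, arcPos_add (k + 2) (by linarith) (by linarith), if_pos (by omega),
    if_neg (by omega), sub_sub_cancel]

theorem arcLabel_fold (g : ℕ) (k : ℤ) (u : I) (hk : k % 4 = 0 ∨ k % 4 = 1) :
    arcLabel g (k + u) = arcLabel g (k + 3 - u) := by
  refine fold_eq_of_interior (arcLabel g) 0 (arcLabel_intCast g) ?_ k u hk
  intro k u h0 h1 hk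
  rw [arcLabel_add g k h0 h1, arcLabel_add g (k + 2) (by linarith) (by linarith),
    if_pos (by omega), if_neg (by omega), add_sub_cancel_right]

theorem eventually_floor_eq {θ : ℝ} (h : Int.fract θ ≠ 0) :
    ∀ᶠ θ' in nhds θ, ⌊θ'⌋ = ⌊θ⌋ ∧ Int.fract θ' ≠ 0 := by
  have h0 : (⌊θ⌋ : ℝ) < θ := by
    have := (Int.fract_nonneg θ).lt_of_ne' h
    rw [Int.fract] at this
    linarith
  filter_upwards [Ioo_mem_nhds h0 (Int.lt_floor_add_one θ)] with θ' hθ'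
  have e : ⌊θ'⌋ = ⌊θ⌋ := Int.floor_eq_iff.2 ⟨hθ'.1.le, hθ'.2⟩
  refine ⟨e, ?_⟩
  rw [Int.fract, e]
  linarith [hθ'.1]

theorem continuousAt_arcPos {θ : ℝ} (h : Int.fract θ ≠ 0) : ContinuousAt arcPos θ := by
  have c : ContinuousAt (fun θ' : ℝ => if ⌊θ⌋ % 4 < 2 then θ' - ⌊θ⌋ else 1 - (θ' - ⌊θ⌋)) θ := by
    split_ifs <;> fun_prop
  refine c.congr ?_
  filter_upwards [eventually_floor_eq h] with θ' hθ'
  rw [arcPos, if_neg hθ'.2, Int.fract, hθ'.1]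

theorem continuousAt_arcLabel (g : ℕ) {θ : ℝ} (h : Int.fract θ ≠ 0) :
    ContinuousAt (arcLabel g) θ := by
  refine (continuousAt_const (y := arcLabel g θ)).congr ?_
  filter_upwards [eventually_floor_eq h] with θ' hθ'
  rw [arcLabel, arcLabel, if_neg hθ'.2, if_neg h, hθ'.1]

theorem arcPos_eq_zero_iff (θ : ℝ) : arcPos θ = 0 ↔ Int.fract θ = 0 := by
  have := Int.fract_lt_one θ
  unfold arcPos
  split_ifs with h h' <;> simp [h]
  linarith

/-- The condition is symmetric under `u ↦ 1 - u`, so the reversed reading of some arcs drops out.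
The right side is continuous in `θ`, although `arcPos` is not. -/
theorem arcPos_near_vertex_iff (θ : ℝ) :
    (arcPos θ < 1 / 4 ∨ 3 / 4 < arcPos θ) ↔ 1 / 4 < |Int.fract θ - 1 / 2| := by
  unfold arcPos
  split_ifs with h h'
  · rw [h]; norm_num [abs_of_neg]
  · rw [lt_abs]; constructor <;> rintro (h | h) <;> first | (left; linarith) | (right; linarith)
  · rw [lt_abs]; constructor <;> rintro (h | h) <;> first | (left; linarith) | (right; linarith)

/-- The map `[0, 1] → [0, 1]` that is constant near the ends. -/
def ramp (u : ℝ) : ℝ := max 0 (min 1 (2 * u - 1 / 2))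

theorem continuous_ramp : Continuous ramp := by
  unfold ramp
  fun_prop

theorem ramp_nonneg (u : ℝ) : 0 ≤ ramp u := le_max_left _ _

theorem ramp_le_one (u : ℝ) : ramp u ≤ 1 := max_le zero_le_one (min_le_left _ _)

theorem ramp_of_lt {u : ℝ} (h : u < 1 / 4) : ramp u = 0 :=
  max_eq_left ((min_le_right _ _).trans (by linarith))

theorem ramp_of_gt {u : ℝ} (h : 3 / 4 < u) : ramp u = 1 := by
  rw [ramp, min_eq_left (by linarith), max_eq_right zero_le_one]

/-- This symmetry makes `flatten` compatible with the folds, which reverse arcs. -/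
theorem ramp_one_sub (u : ℝ) : ramp (1 - u) = 1 - ramp u := by
  unfold ramp
  rcases le_total (2 * u - 1 / 2) 0 with h | h
  · rw [min_eq_right (by linarith : 2 * u - 1 / 2 ≤ 1), max_eq_left h, min_eq_left (by linarith),
      max_eq_right zero_le_one, sub_zero]
  · rcases le_total (2 * u - 1 / 2) 1 with h' | h'
    · rw [min_eq_right h', max_eq_right h, min_eq_right (by linarith), max_eq_right (by linarith)]
      ring
    · rw [min_eq_left h', max_eq_right zero_le_one, min_eq_right (by linarith),
        max_eq_left (by linarith), sub_self]

/-- The map `ℝ → ℝ` that is `ramp` on each arc. -/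
def flatten (θ : ℝ) : ℝ := ⌊θ⌋ + ramp (Int.fract θ)

theorem flatten_add (k : ℤ) {u : ℝ} (h0 : 0 ≤ u) (h1 : u ≤ 1) : flatten (k + u) = k + ramp u := by
  rcases h1.eq_or_lt with rfl | h1
  · have e : (k : ℝ) + 1 = ((k + 1 : ℤ) : ℝ) := by push_cast; ring
    rw [flatten, e, Int.floor_intCast, Int.fract_intCast, ramp_of_lt (by norm_num),
      ramp_of_gt (by norm_num)]
    push_cast; ring
  · have h : ⌊(k : ℝ) + u⌋ = k := Int.floor_eq_iff.2 ⟨by linarith, by linarith⟩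
    rw [flatten, Int.fract, h, add_sub_cancel_left]

theorem continuous_flatten : Continuous flatten := by
  -- The difference `ramp u - u` vanishes at both `0` and `1`, so its periodic extension is
  -- continuous.
  have h : Continuous ((fun u => ramp u - u) ∘ Int.fract : ℝ → ℝ) := by
    refine ContinuousOn.comp_fract'' (continuous_ramp.sub continuous_id).continuousOn ?_
    rw [ramp_of_lt (by norm_num), ramp_of_gt (by norm_num)]
    norm_num
  refine (continuous_id.add h).congr fun θ => ?_
  have := Int.floor_add_fract θ
  change θ + (ramp (Int.fract θ) - Int.fract θ) = ⌊θ⌋ + ramp (Int.fract θ)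
  linarith

theorem flatten_shift (g : ℕ) (θ : ℝ) : flatten (θ + 4 * g) = flatten θ + 4 * g := by
  have e : (4 * g : ℝ) = ((4 * g : ℤ) : ℝ) := by push_cast; ring
  simp only [flatten, e, Int.fract_add_intCast, Int.floor_add_intCast]
  push_cast; ring

end ArcCoordinates

/-! ### Open cover of the surface by the complement and a neighbourhood of the vertex radii -/

namespace IsPolygonMap

variable {g : ℕ} {X : Type} [TopologicalSpace X] {Q : C(ℝ × I, X)} (hQ : IsPolygonMap g Q)
include hQ

/-- The function on `X` induced by a function on the strip. -/
def desc {Y : Type} (f : ℝ × I → Y) (x : X) : Y :=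
  f (Function.surjInv hQ.isQuotientMap.surjective x)

theorem desc_apply {Y : Type} (f : ℝ × I → Y) (hs : ∀ θ t, f (θ + 4 * g, t) = f (θ, t))
    (hf : ∀ (k : ℤ) (u : I), k % 4 = 0 ∨ k % 4 = 1 → f (k + u, 1) = f (k + 3 - u, 1))
    (a : ℝ × I) : hQ.desc f (Q a) = f a :=
  hQ.factor f hs hf _ _ (Function.surjInv_eq hQ.isQuotientMap.surjective (Q a))

/-- The position of a point on its arc. -/
def pos (x : X) : ℝ := hQ.desc (fun a => arcPos a.1) x

/-- The number of the arc below a point. -/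
def label (x : X) : ℤ := hQ.desc (fun a => arcLabel g a.1) x

theorem pos_apply (a : ℝ × I) : hQ.pos (Q a) = arcPos a.1 :=
  hQ.desc_apply (fun a => arcPos a.1) (fun θ _ => arcPos_shift g θ) arcPos_fold a

theorem label_apply (a : ℝ × I) : hQ.label (Q a) = arcLabel g a.1 :=
  hQ.desc_apply (fun a => arcLabel g a.1) (fun θ _ => arcLabel_shift g θ) (arcLabel_fold g) a

/-- The complement of the radii through the vertices. -/
def offVertex : Set X := {x | hQ.pos x ≠ 0}

/-- A neighbourhood of the radii through the vertices. -/
def nearVertex : Set X := {x | hQ.pos x < 1 / 4 ∨ 3 / 4 < hQ.pos x}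

theorem preimage_offVertex : Q ⁻¹' hQ.offVertex = {a | Int.fract a.1 ≠ 0} := by
  ext a
  simp only [Set.mem_preimage, offVertex, Set.mem_ofPred_eq, hQ.pos_apply, ne_eq,
    arcPos_eq_zero_iff]

theorem isOpen_offVertex : IsOpen hQ.offVertex := by
  rw [← hQ.isQuotientMap.isOpen_preimage, preimage_offVertex, isOpen_iff_mem_nhds]
  intro a ha
  filter_upwards [continuousAt_fst.eventually (eventually_floor_eq ha)] with b hb using hb.2

theorem isOpen_nearVertex : IsOpen hQ.nearVertex := by
  rw [← hQ.isQuotientMap.isOpen_preimage]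
  have e : Q ⁻¹' hQ.nearVertex = {a | 1 / 4 < |Int.fract a.1 - 1 / 2|} := by
    ext a
    simp only [Set.mem_preimage, nearVertex, Set.mem_ofPred_eq, hQ.pos_apply,
      arcPos_near_vertex_iff]
  rw [e]
  have h : Continuous ((fun u => |u - 1 / 2|) ∘ Int.fract : ℝ → ℝ) := by
    refine ContinuousOn.comp_fract'' (by fun_prop) ?_
    norm_num [abs_of_neg]
  exact isOpen_lt continuous_const (h.comp continuous_fst)

theorem mem_offVertex_or_nearVertex (x : X) : x ∈ hQ.offVertex ∨ x ∈ hQ.nearVertex := by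
  by_cases h : hQ.pos x = 0
  · right; left; rw [h]; norm_num
  · exact Or.inl h

theorem continuousOn_pos : ContinuousOn hQ.pos hQ.offVertex := by
  rw [hQ.isQuotientMap.continuousOn_isOpen_iff hQ.isOpen_offVertex, preimage_offVertex]
  have e : hQ.pos ∘ Q = fun a => arcPos a.1 := funext hQ.pos_apply
  rw [e]
  exact fun a ha => ((continuousAt_arcPos ha).comp continuousAt_fst).continuousWithinAt

theorem continuousOn_label : ContinuousOn hQ.label hQ.offVertex := by
  rw [hQ.isQuotientMap.continuousOn_isOpen_iff hQ.isOpen_offVertex, preimage_offVertex]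
  have e : hQ.label ∘ Q = fun a => arcLabel g a.1 := funext hQ.label_apply
  rw [e]
  exact fun a ha => ((continuousAt_arcLabel g ha).comp continuousAt_fst).continuousWithinAt

/-! ### The deformation onto the arcs -/

omit hQ in
/-- The straight path in the strip from `(θ, t)` to `(flatten θ, 1)`. -/
def stripTrack (a : ℝ × I) (s : I) : ℝ × I :=
  (a.1 + s * (flatten a.1 - a.1), unitInterval.symm (unitInterval.symm s * unitInterval.symm a.2))

omit hQ in
theorem continuous_stripTrack : Continuous fun p : (ℝ × I) × I => stripTrack p.1 p.2 := by
  have := continuous_flatten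
  unfold stripTrack
  fun_prop

omit hQ in
/-- The paths traced by the deformation. -/
def track (Q : C(ℝ × I, X)) : C(ℝ × I, C(I, X)) :=
  ContinuousMap.curry ⟨fun p : (ℝ × I) × I => Q (stripTrack p.1 p.2),
    Q.continuous.comp continuous_stripTrack⟩

omit hQ in
theorem track_apply (a : ℝ × I) (s : I) : track Q a s = Q (stripTrack a s) := rfl

omit hQ in
theorem flatten_fold_add (k : ℤ) (u s : I) :
    ∃ w : I, (k : ℝ) + u + s * (flatten (k + u) - (k + u)) = k + w ∧
      (k : ℝ) + 3 - u + s * (flatten (k + 3 - u) - (k + 3 - u)) = k + 3 - w := by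
  have h0 := ramp_nonneg (u : ℝ)
  have h1 := ramp_le_one (u : ℝ)
  refine ⟨⟨u + s * (ramp u - u), ?_, ?_⟩, ?_, ?_⟩
  · nlinarith [u.2.1, u.2.2, s.2.1, s.2.2, mul_nonneg s.2.1 h0,
      mul_nonneg u.2.1 (sub_nonneg.2 s.2.2)]
  · nlinarith [u.2.1, u.2.2, s.2.1, s.2.2, mul_nonneg s.2.1 (sub_nonneg.2 h1),
      mul_nonneg (sub_nonneg.2 u.2.2) (sub_nonneg.2 s.2.2)]
  · rw [flatten_add k u.2.1 u.2.2]
    simp only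
    ring
  · have e : (k : ℝ) + 3 - u = ((k + 2 : ℤ) : ℝ) + (1 - u) := by push_cast; ring
    have h := flatten_add (k + 2) (u := 1 - u) (by linarith [u.2.2]) (by linarith [u.2.1])
    rw [← e] at h
    rw [h, ramp_one_sub]
    push_cast
    ring

theorem desc_track (a : ℝ × I) : hQ.desc (track Q) (Q a) = track Q a := by
  refine hQ.desc_apply (track Q) (fun θ t => ?_) (fun k u hk => ?_) a
  · ext s
    rw [track_apply, track_apply]
    have e : stripTrack (θ + 4 * g, t) s =
        ((stripTrack (θ, t) s).1 + 4 * g, (stripTrack (θ, t) s).2) := by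
      refine Prod.ext ?_ rfl
      simp only [stripTrack, flatten_shift]
      ring
    rw [e]
    exact hQ.shift _ _
  · ext s
    rw [track_apply, track_apply, stripTrack, stripTrack]
    -- A point with `t = 1` stays at that height, where the fold is available; its partner moves as
    -- its mirror image.
    simp only [unitInterval.symm_one, mul_zero, unitInterval.symm_zero]
    obtain ⟨w, h1, h2⟩ := flatten_fold_add k u s
    rw [h1, h2]
    exact hQ.fold k w hk

/-- Regarding the deformation as a map into the space of paths `C(I, X)` lets continuity descend
along `Q` itself, rather than along the product of `Q` with `I`. -/
theorem continuous_desc_track : Continuous (hQ.desc (track Q)) := by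
  rw [hQ.isQuotientMap.continuous_iff]
  exact (track Q).continuous.congr fun a => (hQ.desc_track a).symm

/-- The end of the deformation. -/
def flat : C(X, X) := ⟨fun x => hQ.desc (track Q) x 1, by
  have := hQ.continuous_desc_track
  fun_prop⟩

/-- The deformation from the identity to `flat`. -/
def flatHomotopy : (ContinuousMap.id X).Homotopy hQ.flat where
  toFun p := hQ.desc (track Q) p.2 p.1
  continuous_toFun := by
    have := hQ.continuous_desc_track
    fun_prop
  map_zero_left x := by
    obtain ⟨a, rfl⟩ := hQ.isQuotientMap.surjective x
    change hQ.desc (track Q) (Q a) 0 = Q a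
    rw [desc_track, track_apply]
    congr 1
    simp [stripTrack]
  map_one_left x := rfl

/-- The path traced by a point under the deformation. -/
def flatTrack (x : X) : Path x (hQ.flat x) := hQ.flatHomotopy.evalAt x

theorem flat_apply (a : ℝ × I) : hQ.flat (Q a) = Q (flatten a.1, 1) := by
  change hQ.desc (track Q) (Q a) 1 = _
  rw [desc_track, track_apply]
  congr 1
  simp [stripTrack]

theorem vertex' (θ : ℝ) (k : ℤ) (h : θ = k) : Q (θ, 1) = Q (0, 1) := by rw [h, hQ.vertex]

/-- Near the ends of an arc `ramp` is `0` or `1`, so the deformation ends at a vertex, and all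
vertices are one point. -/
theorem flat_nearVertex {x : X} (hx : x ∈ hQ.nearVertex) : hQ.flat x = Q (0, 1) := by
  obtain ⟨a, rfl⟩ := hQ.isQuotientMap.surjective x
  rw [flat_apply]
  simp only [nearVertex, Set.mem_ofPred_eq, hQ.pos_apply, arcPos_near_vertex_iff, lt_abs] at hx
  rcases hx with h | h
  · exact hQ.vertex' _ (⌊a.1⌋ + 1) (by rw [flatten, ramp_of_gt (by linarith)]; push_cast; ring)
  · exact hQ.vertex' _ ⌊a.1⌋ (by rw [flatten, ramp_of_lt (by linarith), add_zero])

theorem flat_offVertex {x : X} (hx : x ∈ hQ.offVertex) :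
    hQ.flat x = Q (hQ.label x + ramp (hQ.pos x), 1) := by
  obtain ⟨⟨θ, t⟩, rfl⟩ := hQ.isQuotientMap.surjective x
  have hu : Int.fract θ ≠ 0 := hQ.preimage_offVertex.subset hx
  have hmod : ∀ (k : ℤ) (y : ℝ), Q ((k % (4 * g) : ℤ) + y, 1) = Q (k + y, 1) := by
    intro k y
    rw [← hQ.shift_int (k / (4 * g)) ((k % (4 * g) : ℤ) + y) 1]
    congr 2
    have h := Int.emod_add_mul_ediv k (4 * g)
    have h' : (k : ℝ) = (k % (4 * g) : ℤ) + (4 * g) * (k / (4 * g) : ℤ) := by exact_mod_cast h.symm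
    rw [h']
    ring
  rw [flat_apply, pos_apply, label_apply, arcPos, arcLabel, if_neg hu, if_neg hu]
  simp only [flatten]
  split_ifs with h
  · rw [hmod]
  · rw [hmod, ramp_one_sub]
    -- An arc read backwards is the mirror image of the arc two places before it.
    have h2 := hQ.fold (⌊θ⌋ - 2) ⟨1 - ramp (Int.fract θ), by linarith [ramp_le_one (Int.fract θ)],
      by linarith [ramp_nonneg (Int.fract θ)]⟩ (by omega)
    rw [h2]
    congr 2
    push_cast
    ring

/-! ### Generation of the fundamental group by the arcs -/

variable {H : Subgroup (FundamentalGroup X (Q (0, 1)))}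

theorem good_of_lift (hH : ∀ k, hQ.arc k ∈ H) {x y : X} (γ : Path x y) (β : C(I, ℝ × I))
    (h : ∀ s, Q (β s) = γ s) : Good H (Path.Homotopic.Quotient.mk γ) := by
  have h2 := hQ.good_seg hH (β 0) (β 1) ((h 0).trans γ.source) ((h 1).trans γ.target)
  rw [seg_eq_mk Q (⟨β, rfl, rfl⟩ : Path (β 0) (β 1))] at h2
  convert h2 using 2
  ext s
  exact (h s).symm

/-- The tracks of the deformation lift to the strip, hence are good; `γ` followed by the track of
its end is homotopic to the track of its start followed by `flat ∘ γ`. -/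
theorem good_of_good_flat (hH : ∀ k, hQ.arc k ∈ H) {x y : X} (γ : Path x y)
    (h : Good H (Path.Homotopic.Quotient.mk (γ.map hQ.flat.continuous))) :
    Good H (Path.Homotopic.Quotient.mk γ) := by
  have htrack : ∀ z, Good H (Path.Homotopic.Quotient.mk (hQ.flatTrack z)) := by
    intro z
    obtain ⟨a, rfl⟩ := hQ.isQuotientMap.surjective z
    refine hQ.good_of_lift hH _ ⟨stripTrack a, continuous_stripTrack.comp
      (continuous_const.prodMk continuous_id)⟩ fun s => ?_
    change _ = hQ.desc (track Q) (Q a) s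
    rw [desc_track]
    rfl
  have key : (γ.trans (hQ.flatTrack y)).Homotopic
      ((hQ.flatTrack x).trans (γ.map hQ.flat.continuous)) :=
    Path.Homotopic.map_trans_evalAt hQ.flatHomotopy γ
  have key2 := Path.Homotopic.Quotient.eq.2 key
  rw [Path.Homotopic.Quotient.mk_trans, Path.Homotopic.Quotient.mk_trans] at key2
  have h2 := hQ.good_trans (hQ.good_trans (htrack x) h) (htrack y).symm
  rw [← key2, Path.Homotopic.Quotient.trans_assoc, Path.Homotopic.Quotient.trans_symm,
    Path.Homotopic.Quotient.trans_refl] at h2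
  exact h2

theorem good_of_nearVertex (hH : ∀ k, hQ.arc k ∈ H) {x y : X} (γ : Path x y)
    (h : ∀ s, γ s ∈ hQ.nearVertex) : Good H (Path.Homotopic.Quotient.mk γ) := by
  refine hQ.good_of_good_flat hH γ (hQ.good_of_lift hH _ (ContinuousMap.const I (0, 1)) fun s => ?_)
  exact (hQ.flat_nearVertex (h s)).symm

/-- The label is continuous with integer values, so it is constant along the path. The deformed path
then stays in one arc, where the position gives a lift. -/
theorem good_of_offVertex (hH : ∀ k, hQ.arc k ∈ H) {x y : X} (γ : Path x y)
    (h : ∀ s, γ s ∈ hQ.offVertex) : Good H (Path.Homotopic.Quotient.mk γ) := by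
  have hl : Continuous fun s => hQ.label (γ s) :=
    continuousOn_univ.1 (hQ.continuousOn_label.comp γ.continuous.continuousOn
      fun s _ => h s)
  have hp : Continuous fun s => hQ.pos (γ s) :=
    continuousOn_univ.1 (hQ.continuousOn_pos.comp γ.continuous.continuousOn
      fun s _ => h s)
  have hconst : ∀ s, hQ.label (γ s) = hQ.label (γ 0) := fun s =>
    PreconnectedSpace.constant inferInstance hl
  refine hQ.good_of_good_flat hH γ (hQ.good_of_lift hH _
    ⟨fun s => (hQ.label (γ 0) + ramp (hQ.pos (γ s)), 1), ?_⟩ fun s => ?_)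
  · exact (continuous_const.add (continuous_ramp.comp hp)).prodMk continuous_const
  · refine Eq.trans ?_ (hQ.flat_offVertex (h s)).symm
    rw [hconst s]
    rfl

theorem good_mk (hH : ∀ k, hQ.arc k ∈ H) {x y : X} (γ : Path x y) :
    Good H (Path.Homotopic.Quotient.mk γ) := by
  let c : Bool → Set I := fun b => γ ⁻¹' (if b then hQ.nearVertex else hQ.offVertex)
  -- By compactness the path is cut into finitely many pieces, each contained in one of the two open
  -- sets.
  obtain ⟨t, h0, hmono, ⟨n, hn⟩, ht⟩ := exists_monotone_Icc_subset_open_cover_unitInterval (c := c)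
    (by
      rintro (_ | _)
      · exact hQ.isOpen_offVertex.preimage γ.continuous
      · exact hQ.isOpen_nearVertex.preimage γ.continuous)
    (by
      intro s _
      rcases hQ.mem_offVertex_or_nearVertex (γ s) with h | h
      · exact Set.mem_iUnion.2 ⟨false, h⟩
      · exact Set.mem_iUnion.2 ⟨true, h⟩)
  have hstep : ∀ m, Good H (Path.Homotopic.Quotient.mk (γ.subpath (t m) (t (m + 1)))) := by
    intro m
    obtain ⟨b, hb⟩ := ht m
    have hr : ∀ s, γ.subpath (t m) (t (m + 1)) s ∈ γ '' Set.Icc (t m) (t (m + 1)) := fun s =>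
      (γ.range_subpath_of_le _ _ (hmono (Nat.le_succ m))).subset ⟨s, rfl⟩
    have hs : ∀ s, γ.subpath (t m) (t (m + 1)) s ∈
        (if b then hQ.nearVertex else hQ.offVertex) := by
      intro s
      obtain ⟨s', hs', e⟩ := hr s
      rw [← e]
      exact hb hs'
    cases b
    · exact hQ.good_of_offVertex hH _ hs
    · exact hQ.good_of_nearVertex hH _ hs
  have hall : ∀ m, Good H (Path.Homotopic.Quotient.mk (γ.subpath (t 0) (t m))) := by
    intro m
    induction m with
    | zero =>
      rw [Path.subpath_self]
      exact hQ.good_refl hH _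
    | succ m ih =>
      have h := hQ.good_trans ih (hstep m)
      rw [← Path.Homotopic.Quotient.mk_trans] at h
      rwa [← Path.Homotopic.Quotient.eq.2 ⟨Path.Homotopy.subpathTransSubpath γ (t 0) (t m) (t (m + 1))⟩]
  have h := hall n
  rw [h0, hn n le_rfl, Path.subpath_zero_one] at h
  intro a b ha hb
  subst ha hb
  exact h a b γ.source.symm γ.target.symm

/-- A subgroup that contains the arcs is the whole fundamental group. -/
theorem eq_top_of_arc_mem (hH : ∀ k, hQ.arc k ∈ H) : H = ⊤ := by
  refine (Subgroup.eq_top_iff' H).2 fun x => ?_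
  obtain ⟨γ, rfl⟩ := Path.Homotopic.Quotient.mk_surjective x
  exact Good.mem (hQ.good_mk hH γ)

end IsPolygonMap

/-! ### Coverings of the surface -/

namespace IsPolygonMap

section Covering

variable {g : ℕ} {X : Type} [TopologicalSpace X] {Q : C(ℝ × I, X)} (hQ : IsPolygonMap g Q)
  {G : Type} [Group G]
include hQ

open Classical in
/-- The coordinate change, relative to the neighbourhood of the radii through the vertices, of the
covering with monodromy `w k` along the `k`-th arc. -/
def cocycle (w : ℤ → G) (i : Bool) (x : X) : G :=
  if i = true ∨ hQ.pos x ≤ 1 / 2 then 1 else (w (hQ.label x))⁻¹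

theorem cocycle_true (w : ℤ → G) (x : X) : hQ.cocycle w true x = 1 := if_pos (Or.inl rfl)

/-- On the overlap the position is below `1 / 4` or above `3 / 4`, so the jump of the cocycle at `1
/ 2` is not seen. -/
theorem eventually_cocycle (w : ℤ → G) (i : Bool) {x : X} (hx : x ∈ hQ.nearVertex)
    (hx' : x ∈ hQ.offVertex) : ∀ᶠ y in nhds x, hQ.cocycle w i y = hQ.cocycle w i x := by
  have hU := hQ.isOpen_offVertex.mem_nhds hx'
  have hp : ContinuousAt hQ.pos x := hQ.continuousOn_pos.continuousAt hU
  have hl : ContinuousAt hQ.label x := hQ.continuousOn_label.continuousAt hU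
  cases i with
  | true => simp [cocycle_true]
  | false =>
    rcases hx with h | h
    · filter_upwards [hp.eventually_lt_const (show hQ.pos x < 1 / 2 by linarith)] with y hy
      rw [cocycle, cocycle, if_pos (Or.inr hy.le), if_pos (Or.inr (by linarith))]
    · filter_upwards [hp.eventually_const_lt (show 1 / 2 < hQ.pos x by linarith),
        hl (IsOpen.mem_nhds (isOpen_discrete {hQ.label x}) rfl)] with y hy hy'
      rw [cocycle, cocycle, if_neg (by simpa using hy), if_neg (by simpa using by linarith),
        show hQ.label y = hQ.label x from hy']

/-- The chart domains of the covering. -/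
def chart (i : Bool) : Set X := if i then hQ.nearVertex else hQ.offVertex

variable [TopologicalSpace G] [DiscreteTopology G]

open Classical in
/-- The covering with monodromy `w k` along the `k`-th arc. -/
def coveringCore (w : ℤ → G) : FiberBundleCore Bool X G where
  baseSet := hQ.chart
  isOpen_baseSet i := by
    cases i
    exacts [hQ.isOpen_offVertex, hQ.isOpen_nearVertex]
  indexAt x := decide (x ∈ hQ.nearVertex)
  mem_baseSet_at x := by
    by_cases h : x ∈ hQ.nearVertex
    · rw [decide_eq_true h]; exact h
    · rw [decide_eq_false h]; exact (hQ.mem_offVertex_or_nearVertex x).resolve_right h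
  coordChange i j x y := hQ.cocycle w j x * (hQ.cocycle w i x)⁻¹ * y
  coordChange_self i x _ y := by rw [mul_inv_cancel, one_mul]
  continuousOn_coordChange i j := by
    by_cases hij : i = j
    · subst hij
      simp only [mul_inv_cancel, one_mul]
      exact continuous_snd.continuousOn
    · rintro ⟨x, y⟩ ⟨⟨hi, hj⟩, -⟩
      have hx : x ∈ hQ.nearVertex ∧ x ∈ hQ.offVertex := by
        cases i <;> cases j
        · exact absurd rfl hij
        · exact ⟨hj, hi⟩
        · exact ⟨hi, hj⟩
        · exact absurd rfl hij
      refine ContinuousAt.continuousWithinAt ?_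
      have c : ContinuousAt
          (fun p : X × G => hQ.cocycle w j x * (hQ.cocycle w i x)⁻¹ * p.2) (x, y) :=
        (continuous_of_discreteTopology (f := fun y : G =>
          hQ.cocycle w j x * (hQ.cocycle w i x)⁻¹ * y)).continuousAt.comp continuousAt_snd
      refine c.congr ?_
      filter_upwards [continuousAt_fst.eventually (hQ.eventually_cocycle w i hx.1 hx.2),
        continuousAt_fst.eventually (hQ.eventually_cocycle w j hx.1 hx.2)] with p h1 h2
      rw [h1, h2]
  coordChange_comp i j k x _ y := by group

theorem isCoveringMap_proj (w : ℤ → G) : IsCoveringMap (hQ.coveringCore w).proj :=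
  FiberBundle.isCoveringMap (F := G) (E := (hQ.coveringCore w).Fiber)

/-- The point with coordinate `u` in the fibre over `x`. -/
def fiberPt (w : ℤ → G) (x : X) (u : G) : (hQ.coveringCore w).proj ⁻¹' {x} :=
  ⟨⟨x, hQ.cocycle w ((hQ.coveringCore w).indexAt x) x * u⟩, rfl⟩

theorem fiberPt_bijective (w : ℤ → G) (x : X) : Function.Bijective (hQ.fiberPt w x) := by
  constructor
  · intro u u' h
    have h1 : (hQ.fiberPt w x u).1 = (hQ.fiberPt w x u').1 := congrArg Subtype.val h
    have h2 := eq_of_heq (Bundle.TotalSpace.mk.inj h1).2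
    exact mul_left_cancel h2
  · rintro ⟨⟨y, u⟩, rfl⟩
    obtain ⟨v, rfl⟩ : ∃ v : G, v = u := ⟨u, rfl⟩
    refine ⟨(hQ.cocycle w ((hQ.coveringCore w).indexAt y) y)⁻¹ * v, Subtype.ext ?_⟩
    exact congrArg (Bundle.TotalSpace.mk y) (mul_inv_cancel_left _ v)

/-- A lift inside a chart has constant chart coordinate, and the chart coordinate of `fiberPt w x u`
is `cocycle w i x * u`. -/
theorem monodromy_chart (w : ℤ → G) (i : Bool) {x y : X} (γ : Path x y)
    (hγ : ∀ s, γ s ∈ hQ.chart i) (u : G) :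
    (hQ.isCoveringMap_proj w).monodromy (Path.Homotopic.Quotient.mk γ) (hQ.fiberPt w x u) =
      hQ.fiberPt w y ((hQ.cocycle w i y)⁻¹ * hQ.cocycle w i x * u) := by
  set Z := hQ.coveringCore w with hZ
  have hsymm : ∀ z (v : G), (Z.localTriv i).toOpenPartialHomeomorph.symm (z, v) =
      (hQ.fiberPt w z ((hQ.cocycle w i z)⁻¹ * v)).1 := by
    intro z v
    rw [Z.localTriv_symm_apply]
    exact congrArg (Bundle.TotalSpace.mk z) (mul_assoc (G := G) _ _ _)
  have hc : Continuous fun s => (Z.localTriv i).toOpenPartialHomeomorph.symm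
      (γ s, hQ.cocycle w i x * u) := by
    refine (Z.localTriv i).toOpenPartialHomeomorph.continuousOn_symm.comp_continuous
      (γ.continuous.prodMk continuous_const) fun s => ?_
    exact (Z.mem_localTriv_target i _).2 (hγ s)
  let Γ : Path (hQ.fiberPt w x u).1
      (hQ.fiberPt w y ((hQ.cocycle w i y)⁻¹ * hQ.cocycle w i x * u)).1 :=
    { toFun := fun s => (Z.localTriv i).toOpenPartialHomeomorph.symm (γ s, hQ.cocycle w i x * u)
      continuous_toFun := hc
      source' := by rw [hsymm, γ.source, inv_mul_cancel_left]
      target' := by rw [hsymm, γ.target, mul_assoc] }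
  refine IsCoveringMap.monodromy_eq_of_map_eq _ (Path.Homotopic.Quotient.mk Γ) ?_
  refine congrArg Path.Homotopic.Quotient.mk (Path.ext (funext fun s => ?_))
  change Z.proj ((Z.localTriv i).toOpenPartialHomeomorph.symm (γ s, hQ.cocycle w i x * u)) = γ s
  rw [hsymm]
  rfl

theorem monodromy_arc_piece (w : ℤ → G) (i : Bool) (k : ℤ) {u u' : ℝ} (huu : u ≤ u')
    (h : ∀ r, u ≤ r → r ≤ u' → Q ((k : ℝ) + r, 1) ∈ hQ.chart i) {a b : ℝ × I}
    (ha1 : a = ((k : ℝ) + u, 1)) (hb1 : b = ((k : ℝ) + u', 1)) {x y : X} (ha : Q a = x)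
    (hb : Q b = y) (v : G) :
    (hQ.isCoveringMap_proj w).monodromy (seg Q a b ha hb) (hQ.fiberPt w x v) =
      hQ.fiberPt w y ((hQ.cocycle w i y)⁻¹ * hQ.cocycle w i x * v) := by
  subst ha hb ha1 hb1
  let P : Path ((k : ℝ) + u, (1 : I)) ((k : ℝ) + u', (1 : I)) :=
    { toFun := fun s => ((k : ℝ) + (u + s * (u' - u)), (1 : I))
      continuous_toFun := by fun_prop
      source' := by simp
      target' := by simp }
  rw [seg_eq_mk Q P]
  refine hQ.monodromy_chart w i _ (fun s => h _ ?_ ?_) v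
  · nlinarith [s.2.1]
  · nlinarith [s.2.2]

theorem mem_chart_true (k : ℤ) {r : ℝ} (h : (0 ≤ r ∧ r ≤ 1 / 8) ∨ (7 / 8 ≤ r ∧ r ≤ 1)) :
    Q ((k : ℝ) + r, 1) ∈ hQ.chart true := by
  change Q ((k : ℝ) + r, 1) ∈ hQ.nearVertex
  simp only [nearVertex, Set.mem_ofPred_eq, hQ.pos_apply, arcPos_near_vertex_iff]
  rcases h with ⟨h0, h1⟩ | ⟨h0, h1⟩
  · have e : Int.fract ((k : ℝ) + r) = r := by
      rw [Int.fract_intCast_add, Int.fract_eq_self]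
      exact ⟨h0, by linarith⟩
    rw [e, lt_abs]; right; linarith
  · rcases h1.eq_or_lt with rfl | h1
    · rw [Int.fract_intCast_add, Int.fract_one, lt_abs]; right; norm_num
    · rw [(floor_fract_add k (by linarith) h1).2, lt_abs]; left; linarith

theorem mem_chart_false (k : ℤ) {r : ℝ} (h0 : 0 < r) (h1 : r < 1) :
    Q ((k : ℝ) + r, 1) ∈ hQ.chart false := by
  change hQ.pos _ ≠ 0
  rw [hQ.pos_apply, ne_eq, arcPos_eq_zero_iff, (floor_fract_add k h0 h1).2]
  exact h0.ne'

theorem monodromy_arc (w : ℤ → G) (k : ℤ) (hk : k % 4 = 0 ∨ k % 4 = 1) (u : G) :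
    (hQ.isCoveringMap_proj w).monodromy (hQ.arc k) (hQ.fiberPt w (Q (0, 1)) u) =
      hQ.fiberPt w (Q (0, 1)) (w (k % (4 * g)) * u) := by
  unfold arc
  -- The end pieces lie in the chart where the cocycle is `1`. Along the middle piece it passes from
  -- `1` to the inverse of `w (k % (4 * g))`, which produces the factor.
  rw [← seg_trans Q _ ((k : ℝ) + 1 / 8, (1 : I)) _ (hQ.vertex k) rfl (hQ.vertex (k + 1)),
    ← seg_trans Q _ ((k : ℝ) + 7 / 8, (1 : I)) _ rfl rfl (hQ.vertex (k + 1)),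
    IsCoveringMap.monodromy_trans_apply, IsCoveringMap.monodromy_trans_apply,
    hQ.monodromy_arc_piece w true k (u := 0) (u' := 1 / 8) (by norm_num)
      (fun r h0 h1 => hQ.mem_chart_true k (Or.inl ⟨h0, h1⟩)) (by simp) rfl,
    hQ.monodromy_arc_piece w false k (u := 1 / 8) (u' := 7 / 8) (by norm_num)
      (fun r h0 h1 => hQ.mem_chart_false k (by linarith) (by linarith)) rfl rfl,
    hQ.monodromy_arc_piece w true k (u := 7 / 8) (u' := 1) (by norm_num)
      (fun r h0 h1 => hQ.mem_chart_true k (Or.inr ⟨h0, h1⟩)) rfl (by simp)]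
  have hk' : k % 4 < 2 := by omega
  have h1 : hQ.cocycle w false (Q ((k : ℝ) + 1 / 8, 1)) = 1 := by
    refine if_pos (Or.inr ?_)
    rw [hQ.pos_apply, arcPos_add k (by norm_num) (by norm_num), if_pos hk']
    norm_num
  have h2 : hQ.cocycle w false (Q ((k : ℝ) + 7 / 8, 1)) = (w (k % (4 * g)))⁻¹ := by
    rw [cocycle, hQ.pos_apply, arcPos_add k (by norm_num) (by norm_num), if_pos hk', if_neg,
      hQ.label_apply, arcLabel_add g k (by norm_num) (by norm_num), if_pos hk']
    norm_num
  simp only [h1, h2, cocycle_true]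
  group

end Covering

/-! ### Freeness of the basic arcs -/

section Free

variable {g : ℕ} {X : Type} [TopologicalSpace X] {Q : C(ℝ × I, X)} (hQ : IsPolygonMap g Q)
include hQ

/-- The monodromy of the covering associated with a family of group elements. -/
theorem exists_monodromy {G : Type} [Group G] (w : ℤ → G) :
    ∃ μ : FundamentalGroup X (Q (0, 1)) →* Equiv.Perm G,
      ∀ k : ℤ, k % 4 = 0 ∨ k % 4 = 1 → μ (hQ.arc k) = MulAction.toPerm (w (k % (4 * g))) := by
  let : TopologicalSpace G := ⊥
  have : DiscreteTopology G := ⟨rfl⟩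
  let e := Equiv.ofBijective _ (hQ.fiberPt_bijective w (Q (0, 1)))
  refine ⟨e.symm.permCongrHom.toMonoidHom.comp
    ((hQ.isCoveringMap_proj w).monodromyPerm (Q (0, 1))), fun k hk => ?_⟩
  ext u
  change e.symm ((hQ.isCoveringMap_proj w).monodromy (hQ.arc k) (e u)) = w (k % (4 * g)) * u
  rw [Equiv.symm_apply_eq]
  exact hQ.monodromy_arc w k hk u

/-- The arcs that are not identified with earlier ones. -/
def basicArc : Fin g ⊕ Fin g → FundamentalGroup X (Q (0, 1)) :=
  Sum.elim (fun i => hQ.arc (4 * (i : ℕ))) (fun i => hQ.arc (4 * (i : ℕ) + 1))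

/-- Take the covering whose monodromy along each basic arc is the corresponding free generator.
Composed with `FreeGroup.lift hQ.basicArc`, the monodromy is left multiplication of the free group
on itself, which is faithful. -/
theorem lift_basicArc_injective : Function.Injective (FreeGroup.lift hQ.basicArc) := by
  let w : ℤ → FreeGroup (Fin g ⊕ Fin g) := fun k =>
    if h : (k / 4).toNat < g then
      if k % 4 = 0 then FreeGroup.of (Sum.inl ⟨_, h⟩) else FreeGroup.of (Sum.inr ⟨_, h⟩)
    else 1
  obtain ⟨μ, hμ⟩ := hQ.exists_monodromy w
  have key : μ.comp (FreeGroup.lift hQ.basicArc) =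
      MulAction.toPermHom (FreeGroup (Fin g ⊕ Fin g)) (FreeGroup (Fin g ⊕ Fin g)) := by
    refine FreeGroup.ext_hom _ _ fun s => ?_
    rw [MonoidHom.comp_apply, FreeGroup.lift_apply_of]
    rcases s with i | i
    · refine (hμ (4 * (i : ℕ)) (by omega)).trans (congrArg MulAction.toPerm ?_)
      have h1 : (4 * (i : ℕ) : ℤ) % (4 * g) = 4 * (i : ℕ) :=
        Int.emod_eq_of_lt (by omega) (by omega)
      have h2 : ((4 * (i : ℕ) : ℤ) / 4).toNat = i := by omega
      simp only [w, h1, h2, i.2, dif_pos, Fin.eta]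
      rw [if_pos (by omega)]
    · refine (hμ (4 * (i : ℕ) + 1) (by omega)).trans (congrArg MulAction.toPerm ?_)
      have h1 : (4 * (i : ℕ) + 1 : ℤ) % (4 * g) = 4 * (i : ℕ) + 1 :=
        Int.emod_eq_of_lt (by omega) (by omega)
      have h2 : ((4 * (i : ℕ) + 1 : ℤ) / 4).toNat = i := by omega
      simp only [w, h1, h2, i.2, dif_pos, Fin.eta]
      rw [if_neg (by omega)]
  have h : Function.Injective (μ ∘ FreeGroup.lift hQ.basicArc) := by
    have e : (μ ∘ FreeGroup.lift hQ.basicArc : _ → _) =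
        MulAction.toPermHom (FreeGroup (Fin g ⊕ Fin g)) (FreeGroup (Fin g ⊕ Fin g)) :=
      congrArg DFunLike.coe key
    rw [e]
    exact MulAction.toPerm_injective
  exact h.of_comp

theorem arc_shift_mul (m k : ℤ) : hQ.arc (k + 4 * g * m) = hQ.arc k := by
  have e : ∀ j : ℤ, (((j + 4 * g * m : ℤ) : ℝ), (1 : I)) = ((j : ℝ) + m * (4 * g), (1 : I)) := by
    intro j; push_cast; congr 1; ring
  refine seg_eq_seg Q ⟨fun a : ℝ × I => (a.1 + m * (4 * g), a.2), by fun_prop⟩ (ContinuousMap.id _)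
    (fun a => hQ.shift_int m a.1 a.2) ((k : ℝ), (1 : I)) (((k + 1 : ℤ) : ℝ), (1 : I))
    (e k).symm ?_ rfl rfl _ _ _ _
  rw [show k + 4 * g * m + 1 = k + 1 + 4 * g * m by ring]
  exact (e (k + 1)).symm

theorem arc_mem_range (k : ℤ) : hQ.arc k ∈ (FreeGroup.lift hQ.basicArc).range := by
  have hpos : ∀ i : ℕ, i < g → ∀ r : ℤ, r = 0 ∨ r = 1 →
      hQ.arc (4 * i + r) ∈ (FreeGroup.lift hQ.basicArc).range := by
    intro i hi r hr
    rcases hr with rfl | rfl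
    · refine ⟨FreeGroup.of (Sum.inl ⟨i, hi⟩), ?_⟩
      rw [FreeGroup.lift_apply_of, add_zero]
      rfl
    · refine ⟨FreeGroup.of (Sum.inr ⟨i, hi⟩), ?_⟩
      rw [FreeGroup.lift_apply_of]
      rfl
  have hg := hQ.genus_pos
  obtain ⟨i, r, m, hi, hr0, hr4, rfl⟩ : ∃ (i : ℕ) (r : ℤ) (m : ℤ), i < g ∧ 0 ≤ r ∧ r < 4 ∧
      k = 4 * i + r + 4 * g * m := by
    have h1 := Int.emod_nonneg (k / 4) (by omega : (g : ℤ) ≠ 0)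
    have h2 := Int.emod_lt_of_pos (k / 4) (by omega : (0 : ℤ) < g)
    have h3 := Int.emod_add_mul_ediv (k / 4) g
    have h4 := Int.emod_add_mul_ediv k 4
    refine ⟨((k / 4) % g).toNat, k % 4, k / 4 / g, by omega, by omega, by omega, ?_⟩
    rw [Int.toNat_of_nonneg h1]
    linear_combination -h4 - 4 * h3
  rw [arc_shift_mul]
  by_cases hr : r < 2
  · exact hpos i hi r (by omega)
  · rw [show 4 * (i : ℤ) + r = 4 * i + (r - 2) + 2 by ring, hQ.arc_add_two _ (by omega)]
    exact inv_mem (hpos i hi (r - 2) (by omega))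

/-- The fundamental group is freely generated by the basic arcs. -/
theorem lift_basicArc_bijective : Function.Bijective (FreeGroup.lift hQ.basicArc) :=
  ⟨hQ.lift_basicArc_injective,
    MonoidHom.range_eq_top.1 (hQ.eq_top_of_arc_mem hQ.arc_mem_range)⟩

end Free

end IsPolygonMap

/-! ### Comparison of two collars -/

theorem exists_eq_intCast {d : ℝ → ℝ} (hd : Continuous d) (h : ∀ x, ∃ n : ℤ, d x = n) :
    ∃ n : ℤ, ∀ x, d x = n := by
  choose N hN using h
  have hc : Continuous N := by
    rw [Int.isClosedEmbedding_coe_real.isInducing.continuous_iff]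
    exact hd.congr hN
  exact ⟨N 0, fun x => by rw [hN x, PreconnectedSpace.constant inferInstance hc (x := x) (y := 0)]⟩

/-- A continuous self-map of the circle lifts to the real line. -/
theorem exists_circle_lift (h : C(Circle, Circle)) : ∃ (f : C(ℝ, ℝ)) (m : ℤ),
    (∀ x, h (Circle.exp (2 * Real.pi * x)) = Circle.exp (2 * Real.pi * f x)) ∧
      ∀ x, f (x + 1) = f x + m := by
  obtain ⟨y, hy⟩ := Circle.exp_surjective (h (Circle.exp (2 * Real.pi * 0)))
  obtain ⟨F, ⟨-, hF⟩, -⟩ := Circle.isCoveringMap_exp.existsUnique_continuousMap_lifts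
    (h.comp ⟨fun x : ℝ => Circle.exp (2 * Real.pi * x), by fun_prop⟩) 0 y hy
  have hF' : ∀ x, Circle.exp (F x) = h (Circle.exp (2 * Real.pi * x)) := fun x => congrFun hF x
  have hpi := Real.pi_ne_zero
  have hd : ∀ x, ∃ n : ℤ, F (x + 1) / (2 * Real.pi) - F x / (2 * Real.pi) = n := by
    intro x
    have e : Circle.exp (F (x + 1)) = Circle.exp (F x) := by
      rw [hF', hF', mul_add, mul_one, Circle.exp_add, Circle.exp_two_pi, mul_one]
    obtain ⟨n, hn⟩ := Circle.exp_eq_exp.1 e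
    refine ⟨n, ?_⟩
    rw [hn]
    field_simp
    ring
  obtain ⟨m, hm⟩ := exists_eq_intCast (by fun_prop) hd
  refine ⟨⟨fun x => F x / (2 * Real.pi), by fun_prop⟩, m, fun x => ?_, fun x => ?_⟩
  · have e : 2 * Real.pi * (F x / (2 * Real.pi)) = F x := mul_div_cancel₀ _ (by positivity)
    exact (hF' x).symm.trans (congrArg Circle.exp e.symm)
  · rw [ContinuousMap.coe_mk]; linarith [hm x]

/-- The function `f' (f x) - x` is continuous with integer values, hence constant; comparing `x = 0`
with `x = 1` gives `m * m' = 1`. -/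
theorem degree_eq_one_or_neg_one {f f' : C(ℝ, ℝ)} {m m' : ℤ} (hf : ∀ x, f (x + 1) = f x + m)
    (hf' : ∀ x, f' (x + 1) = f' x + m')
    (h : ∀ x, Circle.exp (2 * Real.pi * f' (f x)) = Circle.exp (2 * Real.pi * x)) :
    m = 1 ∨ m = -1 := by
  have hpi := Real.pi_ne_zero
  have h1 : ∀ (k : ℤ) x, f' (x + k) = f' x + k * m' := by
    intro k x
    induction k using Int.induction_on with
    | zero => simp
    | succ k ih =>
      push_cast at ih ⊢
      rw [← add_assoc, hf', ih]; ring
    | pred k ih =>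
      have := hf' (x + (-(k : ℝ) - 1))
      push_cast at ih ⊢
      rw [show x + (-(k : ℝ) - 1) + 1 = x + -k by ring, ih] at this
      linarith
  have hd : ∀ x, ∃ n : ℤ, f' (f x) - x = n := by
    intro x
    obtain ⟨n, hn⟩ := Circle.exp_eq_exp.1 (h x)
    refine ⟨n, mul_left_cancel₀ (by positivity : 2 * Real.pi ≠ 0) ?_⟩
    linear_combination hn
  obtain ⟨n, hn⟩ := exists_eq_intCast (by fun_prop) hd
  have h2 : ((m * m' : ℤ) : ℝ) = (1 : ℤ) := by
    have a := hn 0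
    have b := hn (0 + 1)
    rw [hf, h1] at b
    push_cast
    linarith
  exact Int.eq_one_or_neg_one_of_mul_eq_one (Int.cast_injective h2)

namespace Collar

variable {M : Type} [TopologicalSpace M] {B : Set M}

theorem exists_transition (φ ψ : Collar B) :
    ∃ h : C(Circle, Circle), ∀ z, φ.toFun (z, 0) = ψ.toFun (h z, 0) := by
  have hB : ∀ z, φ.toFun (z, 0) ∈ B := fun z => φ.image_zero.subset ⟨(z, 0), rfl, rfl⟩
  choose h hh using fun z => ψ.exists_angle ⟨φ.toFun (z, 0), hB z⟩
  have hi : Topology.IsInducing fun z : Circle => ψ.toFun (z, 0) :=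
    (ψ.isClosedEmbedding.isEmbedding.comp (isEmbedding_prodMkLeft (0 : I))).isInducing
  refine ⟨⟨h, hi.continuous_iff.2 ?_⟩, fun z => (hh z).symm⟩
  have hc : Continuous fun z => φ.toFun (z, 0) := by
    exact φ.isClosedEmbedding.continuous.comp (by fun_prop)
  exact hc.congr fun z => (hh z).symm

theorem exists_angle_map (φ ψ : Collar B) : ∃ (f : C(ℝ, ℝ)) (m : ℤ), (m = 1 ∨ m = -1) ∧
    (∀ x, f (x + 1) = f x + m) ∧ ∀ x, φ.toFun (Circle.exp (2 * Real.pi * x), 0) =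
      ψ.toFun (Circle.exp (2 * Real.pi * f x), 0) := by
  obtain ⟨h, hh⟩ := φ.exists_transition ψ
  obtain ⟨h', hh'⟩ := ψ.exists_transition φ
  obtain ⟨f, m, hf, hm⟩ := exists_circle_lift h
  obtain ⟨f', m', hf', hm'⟩ := exists_circle_lift h'
  refine ⟨f, m, degree_eq_one_or_neg_one hm hm' fun x => ?_, hm, fun x => by rw [hh, hf]⟩
  rw [← hf', ← hf]
  have e := φ.isClosedEmbedding.injective ((hh (Circle.exp (2 * Real.pi * x))).trans (hh' _))
  exact (congrArg Prod.fst e).symm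

/-- An arbitrary collar may parametrise the boundary unevenly and in either direction. Its loop
lifts to the edge `t = 0` of the strip, where only the ends matter, so all that remains of the
parametrisation is a starting angle and a sign `m`. -/
theorem boundaryClass_eq_seg {g : ℕ} (hg : 1 ≤ g) (φ : Collar B) (p : B) (e : Model g ≃ₜ M)
    (he : e '' modelBoundary g = B) : ∃ (θ : ℝ) (m : ℤ) (hθ : modelStrip e (θ, 0) = p),
      (m = 1 ∨ m = -1) ∧ φ.boundaryClass p =
        seg (modelStrip e) (θ, 0) (θ + m * (4 * g), 0) hθ
          (((isPolygonMap_modelStrip hg e).shift_int m θ 0).trans hθ) := by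
  have hg0 : (g : ℝ) ≠ 0 := by positivity
  obtain ⟨f, m, hm, hf, hfφ⟩ := φ.exists_angle_map (modelCollar e he)
  have hz := (φ.exists_angle p).choose_spec
  set z := (φ.exists_angle p).choose
  obtain ⟨x, hx⟩ : ∃ x : ℝ, Circle.exp (2 * Real.pi * x) = z := by
    obtain ⟨y, hy⟩ := Circle.exp_surjective z
    refine ⟨y / (2 * Real.pi), ?_⟩
    rw [mul_div_cancel₀ _ (by positivity), hy]
  have hQ : ∀ s : ℝ, modelStrip e (f (x + s) * (4 * g), 0) =
      φ.toFun (z * Circle.exp (2 * Real.pi * s), 0) := by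
    intro s
    rw [← hx, ← Circle.exp_add, ← mul_add, hfφ, modelCollar_zero, modelStrip_apply]
    simp only
    rw [mul_div_cancel_right₀ _ (by positivity)]
  have h0 : modelStrip e (f x * (4 * g), 0) = p := by
    have := hQ 0
    simpa [hz] using this
  refine ⟨f x * (4 * g), m, h0, hm, ?_⟩
  let γ : Path ((f x * (4 * g), 0) : ℝ × I) (f x * (4 * g) + m * (4 * g), 0) :=
    { toFun := fun s => (f (x + s) * (4 * g), 0)
      continuous_toFun := by fun_prop
      source' := by simp
      target' := by rw [Set.Icc.coe_one, hf, add_mul] }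
  rw [seg_eq_mk _ γ]
  refine congrArg Path.Homotopic.Quotient.mk (Path.ext (funext fun s => ?_))
  exact (hQ s).symm

end Collar

/-! ### Adapted bases -/

theorem trans_symm_trans_self {X : Type*} [TopologicalSpace X] {x y z : X}
    (δ : Path.Homotopic.Quotient x y) (γ : Path.Homotopic.Quotient x z) :
    δ.trans (δ.symm.trans γ) = γ := by
  rw [← Path.Homotopic.Quotient.trans_assoc, Path.Homotopic.Quotient.trans_symm,
    Path.Homotopic.Quotient.refl_trans]

theorem symm_trans_trans_self {X : Type*} [TopologicalSpace X] {x y z : X}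
    (δ : Path.Homotopic.Quotient x y) (γ : Path.Homotopic.Quotient y z) :
    δ.symm.trans (δ.trans γ) = γ := by
  rw [← Path.Homotopic.Quotient.trans_assoc, Path.Homotopic.Quotient.symm_trans,
    Path.Homotopic.Quotient.refl_trans]

/-- Conjugation by a class of paths. -/
def changeBase {X : Type*} [TopologicalSpace X] {x y : X} (δ : Path.Homotopic.Quotient x y) :
    FundamentalGroup X x ≃* FundamentalGroup X y where
  toFun γ := δ.symm.trans (Path.Homotopic.Quotient.trans γ δ)
  invFun γ := δ.trans (Path.Homotopic.Quotient.trans γ δ.symm)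
  left_inv γ := by
    simp [Path.Homotopic.Quotient.trans_assoc, trans_symm_trans_self]
  right_inv γ := by
    simp [Path.Homotopic.Quotient.trans_assoc, symm_trans_trans_self]
  map_mul' γ γ' := by
    change _ = Path.Homotopic.Quotient.trans (δ.symm.trans (Path.Homotopic.Quotient.trans γ' δ))
      (δ.symm.trans (Path.Homotopic.Quotient.trans γ δ))
    change δ.symm.trans ((Path.Homotopic.Quotient.trans γ' γ).trans δ) = _
    simp only [Path.Homotopic.Quotient.trans_assoc, trans_symm_trans_self]

theorem lift_inv_comp_bijective {ι G : Type*} [Group G] {f : ι → G}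
    (hf : Function.Bijective (FreeGroup.lift f)) (e : ι ≃ ι) :
    Function.Bijective (FreeGroup.lift fun i => (f (e i))⁻¹) := by
  let E : FreeGroup ι ≃* FreeGroup ι :=
    MonoidHom.toMulEquiv (FreeGroup.lift fun i => (FreeGroup.of (e i))⁻¹)
      (FreeGroup.lift fun i => (FreeGroup.of (e.symm i))⁻¹)
      (FreeGroup.ext_hom _ _ fun i => by simp) (FreeGroup.ext_hom _ _ fun i => by simp)
  have h : FreeGroup.lift (fun i => (f (e i))⁻¹) = (FreeGroup.lift f).comp E.toMonoidHom :=
    FreeGroup.ext_hom _ _ fun i => by simp [E]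
  rw [h]
  exact hf.comp E.bijective

theorem prod_ofFn_rev {G : Type*} [Group G] {P b : ℕ → G} (h0 : P 0 = 1)
    (hs : ∀ n, P (n + 1) = b n * P n) (n : ℕ) :
    (List.ofFn fun j : Fin n => b (Fin.rev j)).prod = P n := by
  induction n with
  | zero => simp [h0]
  | succ n ih =>
    rw [List.ofFn_succ, List.prod_cons, hs, ← ih]
    simp [Fin.rev_succ]

theorem prod_ofFn_inv {G : Type*} [Group G] {P b : ℕ → G} (h0 : P 0 = 1)
    (hs : ∀ n, P (n + 1) = b n * P n) (n : ℕ) :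
    (List.ofFn fun j : Fin n => (b j)⁻¹).prod = (P n)⁻¹ := by
  induction n with
  | zero => simp [h0]
  | succ n ih =>
    rw [List.ofFn_succ', List.concat_eq_append, List.prod_append, hs, mul_inv_rev, ← ih]
    simp

/-! ### Free bases adapted to the boundary of the polygon -/

namespace IsPolygonMap

variable {g : ℕ} {X : Type} [TopologicalSpace X] {Q : C(ℝ × I, X)} (hQ : IsPolygonMap g Q)
include hQ

/-- The two radial sides of the rectangle of width `4 * g` in the strip have the same image, so its
top and bottom are conjugate along it. -/
theorem changeBase_arcs {p : X} (θ : ℝ) (hθ : Q (θ, 0) = p) (h' : Q (θ + 4 * g, 0) = p) :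
    changeBase (seg Q (0, 1) (θ, 0) rfl hθ) (hQ.arcs (4 * g)) =
      seg Q (θ, 0) (θ + 4 * g, 0) hθ h' := by
  have h1 : seg Q (0, 1) (θ, 0) rfl hθ = seg Q (((4 * g : ℤ) : ℝ), 1) (θ + 4 * g, 0)
      (hQ.vertex _) h' :=
    (hQ.seg_shift (by simp) rfl _ _ _ _).symm
  change (seg Q (0, 1) (θ, 0) rfl hθ).symm.trans (Path.Homotopic.Quotient.trans
    (hQ.arcs (4 * g)) (seg Q (0, 1) (θ, 0) rfl hθ)) = _
  rw [seg_symm]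
  rw [h1]
  unfold arcs
  rw [seg_trans, seg_trans]

theorem exists_basis {p : X} (θ : ℝ) (hθ : Q (θ, 0) = p) (m : ℤ) (hm : m = 1 ∨ m = -1)
    (h' : Q (θ + m * (4 * g), 0) = p) : ∃ a b : Fin g → FundamentalGroup X p,
      Function.Bijective (FreeGroup.lift (Sum.elim a b)) ∧
        seg Q (θ, 0) (θ + m * (4 * g), 0) hθ h' = (List.ofFn fun j => ⁅a j, b j⁆).prod := by
  let E := changeBase (seg Q (0, 1) (θ, 0) rfl hθ)
  have hE : Function.Bijective (FreeGroup.lift (E ∘ hQ.basicArc)) := by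
    have h : FreeGroup.lift (E ∘ hQ.basicArc) =
        E.toMonoidHom.comp (FreeGroup.lift hQ.basicArc) :=
      FreeGroup.ext_hom _ _ fun i => by simp
    rw [h]
    exact E.bijective.comp hQ.lift_basicArc_bijective
  let x : ℕ → FundamentalGroup X p := fun i => E (hQ.arc (4 * i))
  let y : ℕ → FundamentalGroup X p := fun i => E (hQ.arc (4 * i + 1))
  let P : ℕ → FundamentalGroup X p := fun i => E (hQ.arcs (4 * i))
  have h0 : P 0 = 1 := by
    change E (hQ.arcs (4 * (0 : ℕ))) = 1
    rw [Nat.cast_zero, mul_zero, hQ.arcs_zero, map_one]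
  have hs : ∀ n, P (n + 1) = ⁅(y n)⁻¹, (x n)⁻¹⁆ * P n := by
    intro n
    change E (hQ.arcs (4 * (n + 1 : ℕ))) = _
    rw [hQ.arcs_four_mul, map_mul]
    simp only [P, x, y, commutatorElement_def, map_mul, map_inv, inv_inv]
  have hper : Q (θ + 4 * g, 0) = p := (hQ.shift θ 0).trans hθ
  have hP : P g = seg Q (θ, 0) (θ + 4 * g, 0) hθ hper := hQ.changeBase_arcs θ hθ hper
  rcases hm with rfl | rfl
  -- Products in `FundamentalGroup` are read right to left, so the commutators `⁅(y n)⁻¹, (x n)⁻¹⁆`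
  -- occur in decreasing order of `n`.
  · refine ⟨fun j => (y (Fin.rev j))⁻¹, fun j => (x (Fin.rev j))⁻¹, ?_, ?_⟩
    · convert lift_inv_comp_bijective hE
        ((Equiv.sumComm _ _).trans (Equiv.sumCongr Fin.revPerm Fin.revPerm)) using 3
      funext s
      rcases s with s | s <;> rfl
    · refine Eq.trans ?_ (prod_ofFn_rev (b := fun n => ⁅(y n)⁻¹, (x n)⁻¹⁆) h0 hs g).symm
      rw [hP]
      congr 2
      simp
  -- Inverting the product restores the increasing order and exchanges the entries of each
  -- commutator.
  · refine ⟨fun j => (x j)⁻¹, fun j => (y j)⁻¹, ?_, ?_⟩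
    · convert lift_inv_comp_bijective hE (Equiv.refl _) using 3
      funext s
      rcases s with s | s <;> rfl
    · have h2 := prod_ofFn_inv (b := fun n => ⁅(y n)⁻¹, (x n)⁻¹⁆) h0 hs g
      simp only [commutatorElement_inv] at h2
      rw [h2, hP]
      refine Eq.trans ?_ (seg_symm Q (θ, 0) (θ + 4 * g, 0) hθ hper).symm
      exact (hQ.seg_shift rfl (by simp) _ _ _ _).symm

end IsPolygonMap

theorem Collar.exists_isAdaptedBasis {g : ℕ} (hg : 1 ≤ g) {M : Type} [TopologicalSpace M]
    {B : Set M} (hM : IsSurface g M B) (φ : Collar B) (p : B) :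
    ∃ a b : Fin g → FundamentalGroup M (p : M), φ.IsAdaptedBasis p a b := by
  obtain ⟨e, he⟩ := hM
  obtain ⟨θ, m, hθ, hm, hc⟩ := φ.boundaryClass_eq_seg hg p e he
  obtain ⟨a, b, hab, h⟩ := (isPolygonMap_modelStrip hg e).exists_basis θ hθ m hm
    (((isPolygonMap_modelStrip hg e).shift_int m θ 0).trans hθ)
  exact ⟨a, b, hab, hc.trans h⟩

/-! ### The boundary twist and the Johnson filtration -/

section Johnson

variable {M : Type} [TopologicalSpace M] {B : Set M} {p : B}

theorem mem_johnson {i : ℕ} {f : MCG B} :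
    f ∈ johnson p i ↔ ∀ x, x⁻¹ * piAction p f x ∈ lcs (FundamentalGroup M (p : M)) i := by
  constructor
  · intro h x
    exact QuotientGroup.eq.1 (DFunLike.congr_fun (MonoidHom.mem_ker.1 h)
      (QuotientGroup.mk x)).symm
  · intro h
    refine MonoidHom.mem_ker.2 (MonoidHom.ext fun x => ?_)
    induction x using QuotientGroup.induction_on with | _ x
    exact (QuotientGroup.eq.2 (h x)).symm

namespace Collar

variable (φ : Collar B)

theorem piAction_mul_inv (k : ℤ) (x : FundamentalGroup M (p : M)) :
    piAction p (φ.dehnTwist ^ k) x * x⁻¹ = ⁅φ.boundaryClass p ^ k, x⁆ := by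
  rw [piAction_dehnTwist_zpow, commutatorElement_def]

variable {φ} {g : ℕ} {a b : Fin g → FundamentalGroup M (p : M)}

theorem IsAdaptedBasis.boundaryClass_mem (h : φ.IsAdaptedBasis p a b) :
    φ.boundaryClass p ∈ lcs (FundamentalGroup M (p : M)) 1 :=
  h.2 ▸ list_prod_commutator_mem a b

theorem IsAdaptedBasis.zpow_mem_johnson (h : φ.IsAdaptedBasis p a b) (k : ℤ) :
    φ.dehnTwist ^ k ∈ johnson p 2 := by
  refine mem_johnson.2 fun x => ?_
  have e : x⁻¹ * piAction p (φ.dehnTwist ^ k) x = ⁅x⁻¹, φ.boundaryClass p ^ k⁆ := by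
    rw [piAction_dehnTwist_zpow, commutatorElement_def, inv_inv]
    simp only [mul_assoc]
  rw [e]
  exact commutator_mem_lcs (i := 0) (j := 1) (Subgroup.mem_top _) (zpow_mem h.boundaryClass_mem k)

theorem IsAdaptedBasis.zpow_notMem_johnson (hg : 1 ≤ g) (h : φ.IsAdaptedBasis p a b) {k : ℤ}
    (hk : k ≠ 0) {i : ℕ} (hi : 3 ≤ i) : φ.dehnTwist ^ k ∉ johnson p i := by
  intro hmem
  refine commutator_zpow_notMem hg a b h.1 hk ?_
  rw [← h.2, ← piAction_mul_inv]
  have h1 := lcs_anti hi (mem_johnson.1 hmem (a ⟨0, hg⟩))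
  -- The Johnson condition concerns `x⁻¹ * T(x)`; conjugation by `x` turns it into `T(x) * x⁻¹`.
  have hN : (lcs (FundamentalGroup M (p : M)) 3).Normal := inferInstance
  have h2 := hN.conj_mem _ h1 (a ⟨0, hg⟩)
  rwa [mul_inv_cancel_left] at h2

end Collar

end Johnson

end BoundaryTwist

end

theorem mainTheorem8 (g : ℕ) (M : Type) [TopologicalSpace M] (B : Set M)
    (hM : BoundaryTwist.IsSurface g M B) (p : B) :
    Nonempty (BoundaryTwist.Collar B) ∧
    (∀ φ : BoundaryTwist.Collar B,
      (∀ n i : ℕ, BoundaryTwist.homologyAction n i φ.dehnTwist = 1) ∧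
      (∀ hg : 1 ≤ g,
        Infinite (Subgroup.zpowers φ.dehnTwist) ∧
        Subgroup.zpowers φ.dehnTwist ≤ BoundaryTwist.johnson p 2 ∧
        Subgroup.zpowers φ.dehnTwist ⊓ BoundaryTwist.johnson p 3 = ⊥ ∧
        (∃ a b : Fin g → FundamentalGroup M (p : M), φ.IsAdaptedBasis p a b) ∧
        (∀ a b : Fin g → FundamentalGroup M (p : M), φ.IsAdaptedBasis p a b → ∀ k : ℤ,
          ∃ h : BoundaryTwist.piAction p (φ.dehnTwist ^ k) (a ⟨0, hg⟩) * (a ⟨0, hg⟩)⁻¹ ∈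
              BoundaryTwist.lcs (FundamentalGroup M (p : M)) 2,
            BoundaryTwist.grMk _ h =
              k • ∑ j : Fin g, BoundaryTwist.grBracket (i := 1) (j := 0)
                (BoundaryTwist.grBracket (i := 0) (j := 0)
                  (BoundaryTwist.grMk (a j) (Subgroup.mem_top _))
                  (BoundaryTwist.grMk (b j) (Subgroup.mem_top _)))
                (BoundaryTwist.grMk (a ⟨0, hg⟩) (Subgroup.mem_top _)) ∧
            (k ≠ 0 → BoundaryTwist.grMk _ h ≠ 0)))) ∧
    (1 ≤ g → ∀ n i : ℕ, 3 ≤ i →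
      ¬ (BoundaryTwist.homologyAction (B := B) n i).ker ≤ BoundaryTwist.johnson p i) := by
  have hcollar : Nonempty (BoundaryTwist.Collar B) :=
    hM.elim fun e he => ⟨BoundaryTwist.modelCollar e he⟩
  refine ⟨hcollar, fun φ => ⟨φ.homologyAction_dehnTwist, fun hg => ?_⟩, fun hg n i hi hle => ?_⟩
  · obtain ⟨a, b, hab⟩ := φ.exists_isAdaptedBasis hg hM p
    have hpow : ∀ k : ℤ, φ.dehnTwist ^ k ∈ BoundaryTwist.johnson p 3 → k = 0 := fun k hk =>
      by_contra fun h0 => hab.zpow_notMem_johnson hg h0 le_rfl hk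
    refine ⟨?_, ?_, ?_, ⟨a, b, hab⟩, fun a b hab k => ?_⟩
    -- If `T ^ k = 1`, then `T ^ k` lies in `J(3)`, which forces `k = 0`.
    · rw [← SetLike.coe_sort_coe, Set.infinite_coe_iff, infinite_zpowers, isOfFinOrder_iff_zpow_eq_one]
      rintro ⟨k, hk, h1⟩
      exact hk (hpow k (h1 ▸ one_mem _))
    · rintro _ ⟨k, rfl⟩
      exact hab.zpow_mem_johnson k
    · refine (Subgroup.eq_bot_iff_forall _).2 ?_
      rintro _ ⟨⟨k, rfl⟩, hk⟩
      change φ.dehnTwist ^ k = 1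
      rw [hpow k hk, zpow_zero]
    · have e : BoundaryTwist.piAction p (φ.dehnTwist ^ k) (a ⟨0, hg⟩) * (a ⟨0, hg⟩)⁻¹ =
          ⁅(List.ofFn fun j => ⁅a j, b j⁆).prod ^ k, a ⟨0, hg⟩⁆ := by
        rw [BoundaryTwist.Collar.piAction_mul_inv, hab.2]
      rw [e]
      have h := BoundaryTwist.commutator_mem_lcs (i := 1) (j := 0)
        (zpow_mem (BoundaryTwist.list_prod_commutator_mem a b) k) (Subgroup.mem_top (a ⟨0, hg⟩))
      refine ⟨h, BoundaryTwist.grMk_commutator_zpow a b _ k h, fun hk h0 => ?_⟩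
      exact BoundaryTwist.commutator_zpow_notMem hg a b hab.1 hk
        ((BoundaryTwist.grMk_eq_zero_iff h).1 h0)
  -- The twist along any collar is the witness.
  · obtain ⟨φ⟩ := hcollar
    obtain ⟨a, b, hab⟩ := φ.exists_isAdaptedBasis hg hM p
    refine hab.zpow_notMem_johnson hg one_ne_zero hi ?_
    rw [zpow_one]
    exact hle (MonoidHom.mem_ker.2 (φ.homologyAction_dehnTwist n i))
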